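/- Let $n\ge 0$, $d\ge 0$, $p\ge 1$ be integers, let $q\in(-\infty,1)$, and let $\mathcal X=\{x\in\mathbb R^n: g_1(x)\ge 0,\dots,g_m(x)\ge 0\}$, with real polynomials $g_j$, be compact with nonempty interior. Let $\mathbf v_d(x)=(x^\alpha)_{|\alpha|\le d}$, let $\mathfrak A$ be a real $p\times\binom{n+d}{n}$ matrix of rank $p$, and put $\mathbf F(x)=(\mathbf f_1(x),\dots,\mathbf f_p(x))^\top=\mathfrak A\,\mathbf v_d(x)$. For $\mathbf y=(y_\gamma)_{|\gamma|\le 2d}$ let $M_d(\mathbf y)=(y_{\alpha+\beta})_{|\alpha|,|\beta|\le d}$ and $\mathbf M_d(\mathbf y)=\mathfrak A M_d(\mathbf y)\mathfrak A^\top$. Let $\mathcal M_{2d}(\mathcal X)$ be the set of all $\mathbf y=(\int_{\mathcal X} x^\gamma\,d\mu)_{|\gamma|\le 2d}$ with $\mu$ a finite nonnegative Borel measure supported on $\mathcal X$. For a nonnegative definite $p\times p$ matrix $M$ let $\phi_q(M)=\big(\tfrac1p\operatorname{trace}(M^q)\big)^{1/q}$ if $q\in(0,1)$, or if $q<0$ and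 $M$ is positive definite; $\phi_0(M)=\det(M)^{1/p}$ for $M$ positive definite; and $\phi_q(M)=0$ if $q\le 0$ and $M$ is singular. Consider the problem $$\max\ \phi_q(\mathbf M_d(\mathbf y))\quad\text{s.t.}\quad \mathbf M_d(\mathbf y)\succcurlyeq 0,\quad y_\gamma=\sum_{i=1}^{\ell}w_i x_i^\gamma\ (|\gamma|\le 2d),\ x_i\in\mathcal X,\ w_i\ge 0,\ \sum_{i=1}^\ell w_i=1,\ \ell\in\mathbb N. \qquad (\ast)$$ For $\mathbf y$ with $\mathbf M_d(\mathbf y)$ positive definite put $p_{d}(x)=\mathbf F(x)^\top\mathbf M_d(\mathbf y)^{q-1}\mathbf F(x)$, $p^\star(x)=\operatorname{trace}(\mathbf M_d(\mathbf y)^q)-p_d(x)$ and $\Omega(\mathbf y)=\{x\in\mathcal X: p^\star(x)=0\}$. Let $\overline s$ be the dimension of the linear span of the constant $1$ and the products $\mathbf f_i\mathbf f_j$, $1\le i,j\le p$. Then: 1. The set of feasible $\mathbf y$ in $(\ast)$ equals $\{\mathbf y\in\mathcal M_{2d}(\mathcal X): y_0=1\}$. It is convex, and $\mathbf y\mapsto\phi_q(\mathbf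 M_d(\mathbf y))$ is concave on it; that is, $(\ast)$ is a convex optimization problem. 2. There is an optimal solution $\mathbf y^\star$ which is the vector of moments up to order $2d$ of a discrete measure with at least $p$ and at most $\overline s$ support points, all in $\Omega(\mathbf y^\star)$; and $\overline s\le\min\big[1+\tfrac{p(p+1)}2,\binom{n+2d}{n}\big]$. 3. For every optimal solution $\mathbf y^\star$: $\mathbf M_d(\mathbf y^\star)$ is positive definite; $p_d(x)=\|\mathbf M_d(\mathbf y^\star)^{\frac{q-1}2}\mathbf F(x)\|_2^2$ for all $x$; $\mathbf y^\star$ is the vector of moments up to order $2d$ of a discrete measure with at least $p$ and at most $\binom{n+2d}{n}$ support points, all in $\Omega(\mathbf y^\star)$; and there is a discrete measure with at least $p$ and at most $\overline s$ support points, all in $\Omega(\mathbf y^\star)$, whose moment vector is again an optimal solution and has the same information matrix $\mathbf M_d(\mathbf y^\star)$. 4. A vector $\mathbf y$ is an optimal solution of $(\ast)$ if and only if $\mathbf y\in\mathcal M_{2d}(\mathcal X)$, $y_0=1$, $\mathbf M_d(\mathbf y)$ is positive definite, and $p^\star\ge 0$ on $\mathcal X$. 5. If $\mathfrak A$ has full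 column rank $\binom{n+d}{n}$, the optimal solution is unique. -/

import Mathlib

open MeasureTheory

noncomputable section

namespace OptDesign

/-- Multi-indices `α ∈ ℕⁿ` with `|α| ≤ d`. There are `(n + d).choose n` of them. -/
abbrev MultiIdx (n d : ℕ) : Type := {α : Fin n →₀ ℕ // α.degree ≤ d}

instance instFiniteMultiIdx (n d : ℕ) : Finite (MultiIdx n d) :=
  (Finsupp.finite_of_degree_le (σ := Fin n) d).to_subtype

instance instFintypeMultiIdx (n d : ℕ) : Fintype (MultiIdx n d) := Fintype.ofFinite _

/-- The multi-index `0`. -/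
def MultiIdx.zero (n d : ℕ) : MultiIdx n d := ⟨0, by simp⟩

/-- The sum `α + β` of two multi-indices of order at most `d`, of order at most `2d`. -/
def MultiIdx.add {n d : ℕ} (α β : MultiIdx n d) : MultiIdx n (2 * d) :=
  ⟨α.1 + β.1, by
    have h1 := α.2
    have h2 := β.2
    rw [map_add]
    omega⟩

/-- The vector `v_d(x) = (x^α)_{|α| ≤ d}` of monomials. -/
def monomialVec {n : ℕ} (d : ℕ) (x : Fin n → ℝ) : MultiIdx n d → ℝ :=
  fun α => ∏ i, x i ^ (α.1 i)

/-- The basic closed semi-algebraic set `{x : g_j(x) ≥ 0 for all j}`. -/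
def designSpace {n m : ℕ} (g : Fin m → MvPolynomial (Fin n) ℝ) : Set (Fin n → ℝ) :=
  {x | ∀ j, 0 ≤ MvPolynomial.eval x (g j)}

/-- The moment cone of order `k` of `X`: vectors `(y_α)_{|α| ≤ k}` of moments of a finite
nonnegative Borel measure supported on `X`. -/
def momentCone {n : ℕ} (k : ℕ) (X : Set (Fin n → ℝ)) : Set (MultiIdx n k → ℝ) :=
  {y | ∃ μ : Measure (Fin n → ℝ), IsFiniteMeasure μ ∧ μ Xᶜ = 0 ∧
    ∀ α, y α = ∫ x in X, monomialVec k x α ∂μ}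

/-- The normalised moment vectors, `y ∈ M_k(X)` with `y_0 = 1`. -/
def normalizedMoments {n : ℕ} (k : ℕ) (X : Set (Fin n → ℝ)) : Set (MultiIdx n k → ℝ) :=
  {y | y ∈ momentCone k X ∧ y (MultiIdx.zero n k) = 1}

/-- The moment matrix `M_d(y) = (y_{α+β})_{|α|,|β| ≤ d}`. -/
def momentMatrix {n d : ℕ} (y : MultiIdx n (2 * d) → ℝ) :
    Matrix (MultiIdx n d) (MultiIdx n d) ℝ :=
  Matrix.of fun α β => y (α.add β)

/-- The regression functions `F(x) = A v_d(x)`. -/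
def regressor {n d p : ℕ} (A : Matrix (Fin p) (MultiIdx n d) ℝ) (x : Fin n → ℝ) :
    Fin p → ℝ :=
  A.mulVec (monomialVec d x)

/-- The information matrix `A M_d(y) Aᵀ`. -/
def infoMatrix {n d p : ℕ} (A : Matrix (Fin p) (MultiIdx n d) ℝ)
    (y : MultiIdx n (2 * d) → ℝ) : Matrix (Fin p) (Fin p) ℝ :=
  A * momentMatrix y * A.transpose

/-- The power `M^s` of a symmetric matrix, through its spectral decomposition
(`0 ^ s = 0` for `s ≠ 0`; negative powers are meaningful for positive definite `M` only). -/
def matPow {p : ℕ} (M : Matrix (Fin p) (Fin p) ℝ) (s : ℝ) : Matrix (Fin p) (Fin p) ℝ :=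
  cfc (fun t : ℝ => t ^ s) M

open Classical in
/-- Kiefer's criterion `φ_q`, for finite `q`, on nonnegative definite matrices. -/
def kieferPhi {p : ℕ} (q : ℝ) (M : Matrix (Fin p) (Fin p) ℝ) : ℝ :=
  if M.PosDef then
    if q = 0 then M.det ^ (1 / (p : ℝ))
    else ((1 / (p : ℝ)) * (matPow M q).trace) ^ (1 / q)
  else
    if 0 < q then ((1 / (p : ℝ)) * (matPow M q).trace) ^ (1 / q)
    else 0

/-- The vector `(∑ x ∈ S, w x * x^α)_{|α| ≤ k}` of moments of the atomic measure
`∑ x ∈ S, w x • δ_x`. -/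
def atomicMoments {n : ℕ} (k : ℕ) (S : Finset (Fin n → ℝ)) (w : (Fin n → ℝ) → ℝ) :
    MultiIdx n k → ℝ :=
  fun α => ∑ x ∈ S, w x * monomialVec k x α

/-- Feasible moment vectors of the approximate optimal design problem: the moments of
designs `∑ i, w_i δ_{x_i}` with `x_i ∈ X` and `w` in the unit simplex, subject to the
information matrix being nonnegative definite. -/
def designFeasible {n d p : ℕ} (A : Matrix (Fin p) (MultiIdx n d) ℝ)
    (X : Set (Fin n → ℝ)) : Set (MultiIdx n (2 * d) → ℝ) :=
  {y | (infoMatrix A y).PosSemidef ∧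
    ∃ (l : ℕ) (x : Fin l → (Fin n → ℝ)) (w : Fin l → ℝ),
      (∀ i, x i ∈ X) ∧ w ∈ stdSimplex ℝ (Fin l) ∧
      ∀ γ, y γ = ∑ i, w i * monomialVec (2 * d) (x i) γ}

/-- `y` is an optimal solution of: maximise `φ_q (A M_d(y) Aᵀ)` over the designs on `X`. -/
def IsOptimalSolution {n d p : ℕ} (q : ℝ) (A : Matrix (Fin p) (MultiIdx n d) ℝ)
    (X : Set (Fin n → ℝ)) (y : MultiIdx n (2 * d) → ℝ) : Prop :=
  y ∈ designFeasible A X ∧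
    IsMaxOn (fun z => kieferPhi q (infoMatrix A z)) (designFeasible A X) y

/-- The polynomial `p_d(x) = F(x)ᵀ (A M_d(y) Aᵀ)^(q-1) F(x)`. -/
def christoffel {n d p : ℕ} (q : ℝ) (A : Matrix (Fin p) (MultiIdx n d) ℝ)
    (y : MultiIdx n (2 * d) → ℝ) (x : Fin n → ℝ) : ℝ :=
  regressor A x ⬝ᵥ (matPow (infoMatrix A y) (q - 1)).mulVec (regressor A x)

/-- The polynomial `trace ((A M_d(y) Aᵀ)^q) - p_d(x)`. -/
def dualPoly {n d p : ℕ} (q : ℝ) (A : Matrix (Fin p) (MultiIdx n d) ℝ)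
    (y : MultiIdx n (2 * d) → ℝ) (x : Fin n → ℝ) : ℝ :=
  (matPow (infoMatrix A y) q).trace - christoffel q A y x

/-- The zero set `Ω` in `X` of the polynomial above. -/
def contactSet {n d p : ℕ} (q : ℝ) (A : Matrix (Fin p) (MultiIdx n d) ℝ)
    (X : Set (Fin n → ℝ)) (y : MultiIdx n (2 * d) → ℝ) : Set (Fin n → ℝ) :=
  {x | x ∈ X ∧ dualPoly q A y x = 0}

/-- The dimension of the span of the constant `1` and the products `f_i f_j`. -/
def productSpanDim {n d p : ℕ} (A : Matrix (Fin p) (MultiIdx n d) ℝ) : ℕ :=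
  Module.finrank ℝ (Submodule.span ℝ
    (insert (fun _ => (1 : ℝ))
      (Set.range fun ij : Fin p × Fin p =>
        fun x : Fin n → ℝ => regressor A x ij.1 * regressor A x ij.2)))

end OptDesign

end

/-! Everything rests on one Hölder inequality, `kieferPhi_mul_le`: p φ(M)^(q-1) φ(N) ≤ tr(M^(q-1) N)
for M positive definite and N nonnegative definite. Expanded in the two eigenbases, it is a doubly
stochastic average of scalar tangent inequalities for the concave function `powPrim q`; their
strictness gives the equality case `eq_of_trace_le`. Hence φ_q is an infimum of linear functions
(`exists_linear_majorant`), so it is concave and upper semicontinuous, also at singular matrices.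

The feasible set is the convex hull of the image of X under the monomial map. It is compact by
Carathéodory, and it contains every normalised moment vector because a barycentre lies in the closed
convex hull. An optimal solution therefore exists.

On the segment from an optimal M to a feasible N, Hölder at the intermediate matrix P gives
tr(P^(q-1) N) ≤ tr(P^(q-1) M). If M were singular, with N definite and 0 < q, the left side would
blow up as P → M while the right side stays bounded; for q ≤ 0 a singular M has value 0. So M is
definite, and the limit tr(M^(q-1) N) ≤ tr(M^q), taken at point masses, is nonnegativity of the dual
polynomial on X. Conversely, this linear bound and Hölder give optimality.

The dual polynomial has integral zero against an optimal design, so the atoms lie in its zero set.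
Carathéodory, in moment space or in the dual of the span of 1 and the f_i f_j, bounds their number
above; nonsingularity bounds it below. Uniqueness combines the equality case with injectivity of y ↦
A M_d(y) Aᵀ. -/

noncomputable section

namespace OptDesign

open Matrix

section

variable {p : ℕ}

/-! ### Spectral double sums -/

/-- The squared inner products of the eigenvectors of two symmetric matrices. -/
def overlap {M N : Matrix (Fin p) (Fin p) ℝ} (hM : M.IsHermitian) (hN : N.IsHermitian)
    (i j : Fin p) : ℝ :=
  ((star (hM.eigenvectorUnitary : Matrix (Fin p) (Fin p) ℝ) *
    (hN.eigenvectorUnitary : Matrix (Fin p) (Fin p) ℝ)) i j) ^ 2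

lemma overlap_nonneg {M N : Matrix (Fin p) (Fin p) ℝ} (hM : M.IsHermitian)
    (hN : N.IsHermitian) (i j : Fin p) : 0 ≤ overlap hM hN i j := sq_nonneg _

lemma cfc_eq_conj {M : Matrix (Fin p) (Fin p) ℝ} (hM : M.IsHermitian) (f : ℝ → ℝ) :
    cfc f M = (hM.eigenvectorUnitary : Matrix (Fin p) (Fin p) ℝ) *
      diagonal (f ∘ hM.eigenvalues) *
      star (hM.eigenvectorUnitary : Matrix (Fin p) (Fin p) ℝ) := by
  rw [hM.cfc_eq, IsHermitian.cfc, Unitary.conjStarAlgAut_apply]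
  rfl

lemma trace_cfc {M : Matrix (Fin p) (Fin p) ℝ} (hM : M.IsHermitian) (f : ℝ → ℝ) :
    (cfc f M).trace = ∑ i, f (hM.eigenvalues i) := by
  rw [cfc_eq_conj hM, trace_mul_comm, ← mul_assoc, Unitary.coe_star_mul_self, one_mul,
    trace_diagonal]
  rfl

/-- With U, V the eigenvector matrices, only the orthogonal matrix UᵀV links the two spectra, and
the trace sees the squares of its entries. -/
lemma trace_cfc_mul_cfc {M N : Matrix (Fin p) (Fin p) ℝ} (hM : M.IsHermitian)
    (hN : N.IsHermitian) (f g : ℝ → ℝ) :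
    (cfc f M * cfc g N).trace =
      ∑ i, ∑ j, f (hM.eigenvalues i) * g (hN.eigenvalues j) * overlap hM hN i j := by
  set U := (hM.eigenvectorUnitary : Matrix (Fin p) (Fin p) ℝ) with hU
  set V := (hN.eigenvectorUnitary : Matrix (Fin p) (Fin p) ℝ) with hV
  have h : (cfc f M * cfc g N).trace =
      (diagonal (f ∘ hM.eigenvalues) * (star U * V) *
        (diagonal (g ∘ hN.eigenvalues) * (star U * V)ᵀ)).trace := by
    have e : (star U * V)ᵀ = star V * U := by
      rw [← conjTranspose_eq_transpose_of_trivial, ← star_eq_conjTranspose, star_mul, star_star]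
    rw [e, cfc_eq_conj hM, cfc_eq_conj hN, ← hU, ← hV]
    rw [mul_assoc, mul_assoc, trace_mul_comm]
    simp only [mul_assoc]
  rw [h]
  simp only [trace, diag_apply, mul_apply (M := diagonal (f ∘ hM.eigenvalues) * (star U * V)),
    diagonal_mul, transpose_apply, Function.comp]
  refine Finset.sum_congr rfl fun i _ => Finset.sum_congr rfl fun j _ => ?_
  rw [overlap]
  ring

/-- The columns of an orthogonal matrix are unit vectors. With the row version below, the overlaps
are doubly stochastic. -/
lemma sum_overlap_left {M N : Matrix (Fin p) (Fin p) ℝ} (hM : M.IsHermitian)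
    (hN : N.IsHermitian) (g : Fin p → ℝ) :
    ∑ i, ∑ j, g j * overlap hM hN i j = ∑ j, g j := by
  rw [Finset.sum_comm]
  refine Finset.sum_congr rfl fun j _ => ?_
  rw [← Finset.mul_sum]
  have h : ∑ i, overlap hM hN i j = 1 := by
    set W := star (hM.eigenvectorUnitary : Matrix (Fin p) (Fin p) ℝ) *
      (hN.eigenvectorUnitary : Matrix (Fin p) (Fin p) ℝ) with hW
    have hWW : Wᵀ * W = 1 := by
      rw [← conjTranspose_eq_transpose_of_trivial, ← star_eq_conjTranspose]
      exact (Unitary.mem_iff.1 (mul_mem (Unitary.star_mem hM.eigenvectorUnitary.2)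
        hN.eigenvectorUnitary.2)).1
    have := congrFun (congrFun hWW j) j
    rw [mul_apply, one_apply_eq] at this
    rw [← this]
    exact Finset.sum_congr rfl fun i _ => by rw [overlap, transpose_apply, ← hW, sq]
  rw [h, mul_one]

lemma sum_overlap_right {M N : Matrix (Fin p) (Fin p) ℝ} (hM : M.IsHermitian)
    (hN : N.IsHermitian) (f : Fin p → ℝ) :
    ∑ i, ∑ j, f i * overlap hM hN i j = ∑ i, f i := by
  refine Finset.sum_congr rfl fun j _ => ?_
  rw [← Finset.mul_sum]
  have h : ∑ i, overlap hM hN j i = 1 := by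
    set W := star (hM.eigenvectorUnitary : Matrix (Fin p) (Fin p) ℝ) *
      (hN.eigenvectorUnitary : Matrix (Fin p) (Fin p) ℝ) with hW
    have hWW : W * Wᵀ = 1 := by
      rw [← conjTranspose_eq_transpose_of_trivial, ← star_eq_conjTranspose]
      exact (Unitary.mem_iff.1 (mul_mem (Unitary.star_mem hM.eigenvectorUnitary.2)
        hN.eigenvectorUnitary.2)).2
    have := congrFun (congrFun hWW j) j
    rw [mul_apply, one_apply_eq] at this
    rw [← this]
    exact Finset.sum_congr rfl fun i _ => by rw [overlap, transpose_apply, ← hW, sq]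
  rw [h, mul_one]

lemma trace_cfc_mul {M N : Matrix (Fin p) (Fin p) ℝ} (hM : M.IsHermitian)
    (hN : N.IsHermitian) (f : ℝ → ℝ) :
    (cfc f M * N).trace =
      ∑ i, ∑ j, f (hM.eigenvalues i) * hN.eigenvalues j * overlap hM hN i j := by
  conv_lhs => rw [← cfc_id ℝ N hN]
  exact trace_cfc_mul_cfc hM hN f id

lemma trace_sub_sq {M N : Matrix (Fin p) (Fin p) ℝ} (hM : M.IsHermitian)
    (hN : N.IsHermitian) :
    ((M - N) * (M - N)).trace =
      ∑ i, ∑ j, (hM.eigenvalues i - hN.eigenvalues j) ^ 2 * overlap hM hN i j := by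
  have h1 : (M * M).trace = ∑ i, ∑ j, hM.eigenvalues i ^ 2 * overlap hM hN i j := by
    rw [sum_overlap_right, ← trace_cfc hM (fun t => t ^ 2),
      (cfc_pow_id (R := ℝ) M 2 hM : cfc (fun t : ℝ => t ^ 2) M = M ^ 2), sq]
  have h2 : (N * N).trace = ∑ i, ∑ j, hN.eigenvalues j ^ 2 * overlap hM hN i j := by
    rw [sum_overlap_left hM hN (fun j => hN.eigenvalues j ^ 2),
      ← trace_cfc hN (fun t => t ^ 2),
      (cfc_pow_id (R := ℝ) N 2 hN : cfc (fun t : ℝ => t ^ 2) N = N ^ 2), sq]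
  have h3 : (M * N).trace =
      ∑ i, ∑ j, hM.eigenvalues i * hN.eigenvalues j * overlap hM hN i j := by
    conv_lhs => rw [← cfc_id ℝ M hM]
    exact trace_cfc_mul hM hN id
  have h4 : ((M - N) * (M - N)).trace = (M * M).trace + (N * N).trace - 2 * (M * N).trace := by
    rw [sub_mul, mul_sub, mul_sub, trace_sub, trace_sub, trace_sub, trace_mul_comm N M]
    ring
  rw [h4, h1, h2, h3, Finset.mul_sum, ← Finset.sum_add_distrib, ← Finset.sum_sub_distrib]
  refine Finset.sum_congr rfl fun i _ => ?_
  rw [Finset.mul_sum, ← Finset.sum_add_distrib, ← Finset.sum_sub_distrib]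
  exact Finset.sum_congr rfl fun j _ => by ring

/-- The squared Frobenius norm of M - N is the overlap-weighted sum of the squared eigenvalue
differences. -/
lemma eq_of_overlap {M N : Matrix (Fin p) (Fin p) ℝ} (hM : M.IsHermitian)
    (hN : N.IsHermitian)
    (h : ∀ i j, overlap hM hN i j ≠ 0 → hM.eigenvalues i = hN.eigenvalues j) : M = N := by
  have h0 : ((M - N)ᴴ * (M - N)).trace = 0 := by
    rw [(hM.sub hN).eq, trace_sub_sq hM hN]
    refine Finset.sum_eq_zero fun i _ => Finset.sum_eq_zero fun j _ => ?_
    by_cases hij : overlap hM hN i j = 0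
    · rw [hij, mul_zero]
    · rw [h i j hij, sub_self, zero_pow two_ne_zero, zero_mul]
  exact sub_eq_zero.1 (trace_conjTranspose_mul_self_eq_zero_iff.1 h0)

/-! ### Powers of positive definite matrices -/

lemma matPow_zero {M : Matrix (Fin p) (Fin p) ℝ} (hM : M.IsHermitian) : matPow M 0 = 1 := by
  simp only [matPow, Real.rpow_zero]
  exact cfc_const_one ℝ M hM

lemma trace_matPow {M : Matrix (Fin p) (Fin p) ℝ} (hM : M.IsHermitian) (s : ℝ) :
    (matPow M s).trace = ∑ i, hM.eigenvalues i ^ s := trace_cfc hM _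

lemma matPow_mul_matPow {M : Matrix (Fin p) (Fin p) ℝ} (hM : M.PosDef) (s t : ℝ) :
    matPow M s * matPow M t = matPow M (s + t) := by
  rw [matPow, matPow, matPow, cfc_eq_conj hM.1, cfc_eq_conj hM.1, cfc_eq_conj hM.1]
  set U := (hM.1.eigenvectorUnitary : Matrix (Fin p) (Fin p) ℝ) with hU
  have h : star U * U = 1 := Unitary.coe_star_mul_self _
  calc _ = U * diagonal ((fun x => x ^ s) ∘ hM.1.eigenvalues) * (star U * U) *
        diagonal ((fun x => x ^ t) ∘ hM.1.eigenvalues) * star U := by simp only [mul_assoc]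
    _ = _ := by
      rw [h, mul_one, mul_assoc U, diagonal_mul_diagonal]
      congr 3
      ext i
      exact (Real.rpow_add (hM.eigenvalues_pos i) s t).symm

lemma matPow_one {M : Matrix (Fin p) (Fin p) ℝ} (hM : M.IsHermitian) : matPow M 1 = M := by
  simp only [matPow, Real.rpow_one]
  exact cfc_id' ℝ M hM

lemma matPow_mul_self {M : Matrix (Fin p) (Fin p) ℝ} (hM : M.PosDef) (q : ℝ) :
    matPow M (q - 1) * M = matPow M q := by
  conv_lhs => rw [← matPow_one hM.1, matPow_one hM.1]
  nth_rewrite 2 [← matPow_one hM.1]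
  rw [matPow_mul_matPow hM, sub_add_cancel]

lemma matPow_isHermitian {M : Matrix (Fin p) (Fin p) ℝ} (s : ℝ) : (matPow M s).IsHermitian :=
  IsSelfAdjoint.cfc (f := fun t : ℝ => t ^ s) (a := M)

lemma matPow_posDef {M : Matrix (Fin p) (Fin p) ℝ} (hM : M.PosDef) (s : ℝ) :
    (matPow M s).PosDef := by
  rw [matPow, cfc_eq_conj hM.1, Matrix.IsUnit.posDef_star_right_conjugate_iff]
  · exact PosDef.diagonal fun i => Real.rpow_pos_of_pos (hM.eigenvalues_pos i) s
  · exact Unitary.isUnit_coe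

lemma trace_matPow_pos (hp : 1 ≤ p) {M : Matrix (Fin p) (Fin p) ℝ} (hM : M.PosDef) (s : ℝ) :
    0 < (matPow M s).trace := by
  rw [trace_matPow hM.1]
  have : Nonempty (Fin p) := ⟨⟨0, hp⟩⟩
  exact Finset.sum_pos (fun i _ => Real.rpow_pos_of_pos (hM.eigenvalues_pos i) s)
    Finset.univ_nonempty

end

section

variable {p : ℕ}

/-! ### Tangents of power functions -/

/-- The primitive of `t ↦ t ^ (q - 1)` on the positive reals. -/
def powPrim (q x : ℝ) : ℝ := if q = 0 then Real.log x else x ^ q / q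

/-- The distance at `b` from the function `powPrim q` to its tangent at `a`. -/
def tangentGap (q a b : ℝ) : ℝ := a ^ (q - 1) * b - a ^ q - (powPrim q b - powPrim q a)

lemma tangentGap_self {q a : ℝ} (ha : 0 < a) : tangentGap q a a = 0 := by
  rw [tangentGap, ← Real.rpow_add_one ha.ne', sub_add_cancel]
  ring

/-- Scaling moves the point of tangency to 1. The value t = 0 is admitted only for q > 0, where the
primitive has a finite limit there. -/
lemma powPrim_mul {q a t : ℝ} (ha : 0 < a) (ht : 0 < t ∨ 0 ≤ t ∧ 0 < q) :
    powPrim q (a * t) - powPrim q a = a ^ q * (powPrim q t - powPrim q 1) := by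
  have ht0 : 0 ≤ t := by rcases ht with h | h <;> linarith [h]
  unfold powPrim
  split_ifs with h
  · rcases ht with ht | ⟨-, hq⟩
    · rw [h, Real.log_mul ha.ne' ht.ne', Real.rpow_zero, Real.log_one]
      ring
    · exact absurd h hq.ne'
  · rw [Real.mul_rpow ha.le ht0, Real.one_rpow]
    ring

lemma powPrim_lt_tangent_one {q t : ℝ} (hq : q < 1) (ht : 0 < t ∨ 0 ≤ t ∧ 0 < q) (h1 : t ≠ 1) :
    powPrim q t - powPrim q 1 < t - 1 := by
  unfold powPrim
  rcases lt_trichotomy q 0 with h | h | h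
  -- For q < 0: t^q ≥ 1 + q log t > 1 + q (t - 1), and dividing by q reverses the order.
  · have ht : 0 < t := by rcases ht with ht | ⟨-, ht⟩ <;> linarith
    have e1 := Real.log_lt_sub_one_of_pos ht h1
    have e2 := Real.add_one_le_exp (Real.log t * q)
    rw [← Real.rpow_def_of_pos ht] at e2
    rw [if_neg h.ne, if_neg h.ne, Real.one_rpow, ← sub_div, div_lt_iff_of_neg h]
    nlinarith
  · have ht : 0 < t := by rcases ht with ht | ⟨-, ht⟩ <;> linarith
    rw [if_pos h, if_pos h, Real.log_one, sub_zero]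
    exact Real.log_lt_sub_one_of_pos ht h1
  · have ht : 0 ≤ t := by rcases ht with ht | ⟨ht, -⟩ <;> linarith
    have e := rpow_one_add_lt_one_add_mul_self (s := t - 1) (by linarith) (sub_ne_zero.2 h1) h hq
    rw [add_sub_cancel] at e
    rw [if_neg h.ne', if_neg h.ne', Real.one_rpow, ← sub_div, div_lt_iff₀ h]
    linarith

lemma tangentGap_pos {q a b : ℝ} (hq : q < 1) (ha : 0 < a) (hb : 0 < b ∨ 0 ≤ b ∧ 0 < q)
    (hab : a ≠ b) : 0 < tangentGap q a b := by
  have ht : 0 < b / a ∨ 0 ≤ b / a ∧ 0 < q :=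
    hb.imp (fun h => div_pos h ha) (fun h => ⟨div_nonneg h.1 ha.le, h.2⟩)
  have h1 : b / a ≠ 1 := fun h => hab ((div_eq_one_iff_eq ha.ne').1 h).symm
  have e := powPrim_mul ha ht
  rw [mul_div_cancel₀ _ ha.ne'] at e
  rw [tangentGap, e, Real.rpow_sub_one ha.ne']
  have := mul_lt_mul_of_pos_left (powPrim_lt_tangent_one hq ht h1) (Real.rpow_pos_of_pos ha q)
  have e2 : a ^ q / a * b = a ^ q * (b / a) := by ring
  rw [e2]
  linarith

lemma tangentGap_nonneg {q a b : ℝ} (hq : q < 1) (ha : 0 < a) (hb : 0 < b ∨ 0 ≤ b ∧ 0 < q) :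
    0 ≤ tangentGap q a b := by
  rcases eq_or_ne a b with rfl | h
  · exact (tangentGap_self ha).ge
  · exact (tangentGap_pos hq ha hb h).le

/-! ### Kiefer's criterion -/

lemma kieferPhi_eq_rpow {q : ℝ} {M : Matrix (Fin p) (Fin p) ℝ} (hq : q ≠ 0)
    (h : M.PosDef ∨ 0 < q) :
    kieferPhi q M = ((1 / (p : ℝ)) * (matPow M q).trace) ^ (1 / q) := by
  unfold kieferPhi
  rw [if_neg hq]
  rcases h with h | h
  · rw [if_pos h]
  · rw [if_pos h, ite_self]

lemma kieferPhi_zero {M : Matrix (Fin p) (Fin p) ℝ} (h : M.PosDef) :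
    kieferPhi 0 M = M.det ^ (1 / (p : ℝ)) := by
  rw [kieferPhi, if_pos h, if_pos rfl]

lemma kieferPhi_of_not_posDef {q : ℝ} {M : Matrix (Fin p) (Fin p) ℝ} (hq : q ≤ 0)
    (h : ¬ M.PosDef) : kieferPhi q M = 0 := by
  rw [kieferPhi, if_neg h, if_neg hq.not_gt]

lemma trace_matPow_nonneg {M : Matrix (Fin p) (Fin p) ℝ} (hM : M.PosSemidef) (s : ℝ) :
    0 ≤ (matPow M s).trace := by
  rw [trace_matPow hM.1]
  exact Finset.sum_nonneg fun i _ => Real.rpow_nonneg (hM.eigenvalues_nonneg i) s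

lemma kieferPhi_nonneg {q : ℝ} {M : Matrix (Fin p) (Fin p) ℝ} (hM : M.PosSemidef) :
    0 ≤ kieferPhi q M := by
  by_cases h : M.PosDef ∨ 0 < q
  · by_cases hq : q = 0
    · subst hq
      rw [kieferPhi_zero (h.resolve_right (lt_irrefl _))]
      exact Real.rpow_nonneg hM.det_nonneg _
    · rw [kieferPhi_eq_rpow hq h]
      exact Real.rpow_nonneg (mul_nonneg (by positivity) (trace_matPow_nonneg hM q)) _
  · push Not at h
    rw [kieferPhi_of_not_posDef h.2 h.1]

lemma kieferPhi_pos (hp : 1 ≤ p) {q : ℝ} {M : Matrix (Fin p) (Fin p) ℝ} (hM : M.PosDef) :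
    0 < kieferPhi q M := by
  by_cases hq : q = 0
  · subst hq
    rw [kieferPhi_zero hM]
    exact Real.rpow_pos_of_pos hM.det_pos _
  · rw [kieferPhi_eq_rpow hq (Or.inl hM)]
    have : (0 : ℝ) < p := by exact_mod_cast hp
    exact Real.rpow_pos_of_pos (mul_pos (by positivity) (trace_matPow_pos hp hM q)) _

lemma posDef_or_pos_of_kieferPhi_pos {q : ℝ} {M : Matrix (Fin p) (Fin p) ℝ}
    (h : 0 < kieferPhi q M) : M.PosDef ∨ 0 < q := by
  by_contra! hc
  exact h.ne' (kieferPhi_of_not_posDef hc.2 hc.1)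

/-- This form also covers q = 0, where both sides equal p; it spares later proofs the case split. -/
lemma kieferPhi_rpow (hp : 1 ≤ p) {q : ℝ} {M : Matrix (Fin p) (Fin p) ℝ} (hM : M.PosSemidef)
    (h : M.PosDef ∨ 0 < q) : p * kieferPhi q M ^ q = (matPow M q).trace := by
  have hp' : (0 : ℝ) < p := by exact_mod_cast hp
  by_cases hq : q = 0
  · subst hq
    rw [matPow_zero hM.1, trace_one, Real.rpow_zero, mul_one, Fintype.card_fin]
  · rw [kieferPhi_eq_rpow hq h, ← Real.rpow_mul (mul_nonneg (by positivity)
      (trace_matPow_nonneg hM q)), one_div_mul_cancel hq, Real.rpow_one]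
    field_simp

/-- The criterion is the quasi-arithmetic mean of the eigenvalues generated by `powPrim q`. -/
lemma sum_powPrim_eigenvalues (hp : 1 ≤ p) {q s : ℝ} {N : Matrix (Fin p) (Fin p) ℝ}
    (hN : N.PosSemidef) (h : 0 < kieferPhi q N) (hs : 0 < s) :
    ∑ j, powPrim q (s * hN.1.eigenvalues j) = p * powPrim q (s * kieferPhi q N) := by
  have hp' : (0 : ℝ) < p := by exact_mod_cast hp
  have hc := posDef_or_pos_of_kieferPhi_pos h
  by_cases hq : q = 0
  · subst hq
    have hD := hc.resolve_right (lt_irrefl _)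
    simp only [powPrim, if_true]
    rw [Real.log_mul hs.ne' h.ne', kieferPhi_zero hD, Real.log_rpow hD.det_pos,
      hN.1.det_eq_prod_eigenvalues]
    simp only [RCLike.ofReal_real_eq_id, id]
    rw [Real.log_prod fun i _ => (hD.eigenvalues_pos i).ne', mul_add, ← mul_assoc,
      mul_one_div_cancel hp'.ne', one_mul]
    simp only [fun j => Real.log_mul hs.ne' (hD.eigenvalues_pos j).ne', Finset.sum_add_distrib,
      Finset.sum_const, Finset.card_univ, Fintype.card_fin, nsmul_eq_mul]
  · simp only [powPrim, if_neg hq]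
    rw [← Finset.sum_div, Real.mul_rpow hs.le h.le]
    have e := kieferPhi_rpow hp hN hc
    rw [trace_matPow hN.1] at e
    rw [← mul_div_assoc, mul_left_comm, e, Finset.mul_sum]
    congr 1
    exact Finset.sum_congr rfl fun j _ => Real.mul_rpow hs.le (hN.eigenvalues_nonneg j)

/-- The factor φ(M)/φ(N) gives the scaled N the same criterion value as M, so the two `powPrim` sums
cancel and only traces remain. -/
lemma sum_tangentGap (hp : 1 ≤ p) {q : ℝ} {M N : Matrix (Fin p) (Fin p) ℝ}
    (hM : M.PosDef) (hN : N.PosSemidef) (h : 0 < kieferPhi q N) :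
    ∑ i, ∑ j, tangentGap q (hM.1.eigenvalues i)
        (kieferPhi q M / kieferPhi q N * hN.1.eigenvalues j) * overlap hM.1 hN.1 i j =
      kieferPhi q M / kieferPhi q N * (matPow M (q - 1) * N).trace - (matPow M q).trace := by
  have hMp : 0 < kieferPhi q M := kieferPhi_pos hp hM
  set s := kieferPhi q M / kieferPhi q N with hs
  have hs0 : 0 < s := div_pos hMp h
  have e1 := sum_powPrim_eigenvalues hp hN h hs0
  have e2 := sum_powPrim_eigenvalues hp hM.posSemidef hMp one_pos
  rw [hs, div_mul_cancel₀ _ h.ne', ← hs] at e1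
  simp only [one_mul] at e2
  have e3 := sum_overlap_left hM.1 hN.1 (fun j => powPrim q (s * hN.1.eigenvalues j))
  have e4 := sum_overlap_right hM.1 hN.1 (fun j => powPrim q (hM.1.eigenvalues j))
  have e5 := sum_overlap_right hM.1 hN.1 (fun j => hM.1.eigenvalues j ^ q)
  rw [e1] at e3
  rw [e2] at e4
  rw [trace_matPow hM.1, matPow, trace_cfc_mul hM.1 hN.1, ← e5]
  have e6 := e3.trans e4.symm
  rw [← sub_eq_zero] at e6
  refine Eq.trans ?_ (sub_zero _)
  refine Eq.trans ?_ (congrArg _ e6)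
  simp only [← Finset.sum_sub_distrib, Finset.mul_sum]
  refine Finset.sum_congr rfl fun i _ => Finset.sum_congr rfl fun j _ => ?_
  rw [tangentGap]
  ring

lemma pos_scaled_eigenvalue {q s : ℝ} {N : Matrix (Fin p) (Fin p) ℝ} (hN : N.PosSemidef)
    (hs : 0 < s) (h : N.PosDef ∨ 0 < q) (j : Fin p) :
    0 < s * hN.1.eigenvalues j ∨ 0 ≤ s * hN.1.eigenvalues j ∧ 0 < q :=
  h.imp (fun h => mul_pos hs (h.eigenvalues_pos j))
    (fun h => ⟨mul_nonneg hs.le (hN.eigenvalues_nonneg j), h⟩)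

/-- **Hölder's inequality** for Kiefer's criterion. -/
lemma kieferPhi_mul_le (hp : 1 ≤ p) {q : ℝ} (hq : q < 1) {M N : Matrix (Fin p) (Fin p) ℝ}
    (hM : M.PosDef) (hN : N.PosSemidef) :
    p * kieferPhi q M ^ (q - 1) * kieferPhi q N ≤ (matPow M (q - 1) * N).trace := by
  have hMp : 0 < kieferPhi q M := kieferPhi_pos hp hM
  rcases (kieferPhi_nonneg (q := q) hN).eq_or_lt with h | h
  · rw [← h, mul_zero, matPow, trace_cfc_mul hM.1 hN.1]
    exact Finset.sum_nonneg fun i _ => Finset.sum_nonneg fun j _ => mul_nonneg (mul_nonneg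
      (Real.rpow_nonneg (hM.eigenvalues_pos i).le _) (hN.eigenvalues_nonneg j))
      (overlap_nonneg _ _ i j)
  · have hs0 : 0 < kieferPhi q M / kieferPhi q N := div_pos hMp h
    have hsum := sum_tangentGap hp hM hN h
    have hnn : 0 ≤ kieferPhi q M / kieferPhi q N * (matPow M (q - 1) * N).trace
        - (matPow M q).trace := by
      rw [← hsum]
      exact Finset.sum_nonneg fun i _ => Finset.sum_nonneg fun j _ => mul_nonneg
        (tangentGap_nonneg hq (hM.eigenvalues_pos i) (pos_scaled_eigenvalue hN hs0
          (posDef_or_pos_of_kieferPhi_pos h) j)) (overlap_nonneg _ _ i j)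
    rw [← kieferPhi_rpow hp hM.posSemidef (Or.inl hM), sub_nonneg, div_mul_eq_mul_div,
      le_div_iff₀ h] at hnn
    rw [Real.rpow_sub_one hMp.ne']
    refine le_of_mul_le_mul_left ?_ hMp
    calc _ = p * kieferPhi q M ^ q * kieferPhi q N := by field_simp
      _ ≤ _ := hnn

/-- Equality case of Hölder: every weighted tangent gap vanishes, so by strict concavity eigenvalues
with nonzero overlap agree. -/
lemma eq_of_trace_le (hp : 1 ≤ p) {q : ℝ} (hq : q < 1) {M N : Matrix (Fin p) (Fin p) ℝ}
    (hM : M.PosDef) (hN : N.PosDef) (hphi : kieferPhi q M = kieferPhi q N)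
    (h : (matPow M (q - 1) * N).trace ≤ (matPow M q).trace) : M = N := by
  have hNp : 0 < kieferPhi q N := kieferPhi_pos hp hN
  have hsum := sum_tangentGap hp hM hN.posSemidef hNp
  rw [hphi, div_self hNp.ne', one_mul] at hsum
  simp only [one_mul] at hsum
  have hnn : ∀ i j, 0 ≤ tangentGap q (hM.1.eigenvalues i) (hN.1.eigenvalues j) *
      overlap hM.1 hN.1 i j := fun i j => mul_nonneg (tangentGap_nonneg hq (hM.eigenvalues_pos i)
        (Or.inl (hN.eigenvalues_pos j))) (overlap_nonneg _ _ i j)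
  have h0 : ∑ i, ∑ j, tangentGap q (hM.1.eigenvalues i) (hN.1.eigenvalues j) *
      overlap hM.1 hN.1 i j = 0 :=
    le_antisymm (by rw [hsum]; linarith)
      (Finset.sum_nonneg fun i _ => Finset.sum_nonneg fun j _ => hnn i j)
  refine eq_of_overlap hM.1 hN.1 fun i j hij => ?_
  by_contra hne
  have hi := (Finset.sum_eq_zero_iff_of_nonneg
    fun i _ => Finset.sum_nonneg fun j _ => hnn i j).1 h0 i (Finset.mem_univ i)
  have hj := (Finset.sum_eq_zero_iff_of_nonneg fun j _ => hnn i j).1 hi j (Finset.mem_univ j)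
  exact (mul_pos (tangentGap_pos hq (hM.eigenvalues_pos i) (Or.inl (hN.eigenvalues_pos j)) hne)
    ((overlap_nonneg _ _ i j).lt_of_ne' hij)).ne' hj

/-! ### Approximation of singular matrices -/

lemma trace_cfc_add_smul_one {N : Matrix (Fin p) (Fin p) ℝ} (hN : N.IsHermitian) (f : ℝ → ℝ)
    (ε : ℝ) : (cfc f (N + ε • (1 : Matrix (Fin p) (Fin p) ℝ))).trace =
      ∑ i, f (hN.eigenvalues i + ε) := by
  have hc : ContinuousOn (fun t : ℝ => t) (spectrum ℝ N) := N.finite_real_spectrum.continuousOn _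
  -- The spectrum is finite, so every function is continuous on it and f needs no regularity.
  have e : cfc (fun t : ℝ => t + ε) N = N + ε • (1 : Matrix (Fin p) (Fin p) ℝ) := by
    refine (cfc_add_const ε (fun t => t) N hc hN).trans ?_
    rw [cfc_id' ℝ N hN, Algebra.algebraMap_eq_smul_one]
  have e' : cfc (fun t : ℝ => f (t + ε)) N = cfc f (cfc (fun t : ℝ => t + ε) N) :=
    cfc_comp' f (fun t : ℝ => t + ε) N ((N.finite_real_spectrum.image _).continuousOn f)
      (N.finite_real_spectrum.continuousOn _) hN
  rw [← e, ← e', trace_cfc hN]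

lemma add_smul_one_posDef {N : Matrix (Fin p) (Fin p) ℝ} (hN : N.PosSemidef) {ε : ℝ}
    (hε : 0 < ε) : (N + ε • (1 : Matrix (Fin p) (Fin p) ℝ)).PosDef :=
  PosDef.posSemidef_add hN (PosDef.one.smul hε)

lemma exists_kieferPhi_add_smul_one_lt (hp : 1 ≤ p) {q c : ℝ}
    {N : Matrix (Fin p) (Fin p) ℝ} (hN : N.PosSemidef) (hND : ¬ N.PosDef)
    (hc : kieferPhi q N < c) :
    ∃ ε : ℝ, 0 < ε ∧ kieferPhi q (N + ε • (1 : Matrix (Fin p) (Fin p) ℝ)) < c := by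
  have hp' : (0 : ℝ) < p := by exact_mod_cast hp
  obtain ⟨k, hk⟩ : ∃ k, hN.1.eigenvalues k = 0 := by
    by_contra! h
    exact hND (hN.1.posDef_iff_eigenvalues_pos.2
      fun i => (hN.eigenvalues_nonneg i).lt_of_ne' (h i))
  rcases lt_trichotomy q 0 with hq | hq | hq
  · rw [kieferPhi_of_not_posDef hq.le hND] at hc
    have hk0 : (0 : ℝ) < (1 / (p : ℝ)) ^ (1 / q) := Real.rpow_pos_of_pos (by positivity) _
    -- The zero eigenvalue alone contributes ε^q to the trace, so the criterion is at most
    -- (1/p)^(1/q) ε; this ε makes that bound c/2.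
    refine ⟨c / 2 / (1 / (p : ℝ)) ^ (1 / q), by positivity, ?_⟩
    set ε := c / 2 / (1 / (p : ℝ)) ^ (1 / q) with hε
    have hε0 : 0 < ε := by positivity
    rw [kieferPhi_eq_rpow hq.ne (Or.inl (add_smul_one_posDef hN hε0)), matPow,
      trace_cfc_add_smul_one hN.1]
    have h1 : ε ^ q ≤ ∑ i, (hN.1.eigenvalues i + ε) ^ q := by
      have := Finset.single_le_sum (f := fun i => (hN.1.eigenvalues i + ε) ^ q)
        (fun i _ => Real.rpow_nonneg (add_nonneg (hN.eigenvalues_nonneg i) hε0.le) q)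
        (Finset.mem_univ k)
      simpa [hk] using this
    calc _ ≤ ((1 / (p : ℝ)) * ε ^ q) ^ (1 / q) :=
          Real.rpow_le_rpow_of_nonpos (by positivity)
            (mul_le_mul_of_nonneg_left h1 (by positivity)) (one_div_neg.2 hq).le
      _ = (1 / (p : ℝ)) ^ (1 / q) * ε := by
          rw [Real.mul_rpow (by positivity) (by positivity), ← Real.rpow_mul hε0.le,
            mul_one_div_cancel hq.ne, Real.rpow_one]
      _ = c / 2 := by rw [hε]; field_simp
      _ < c := by linarith
  · subst hq
    rw [kieferPhi_of_not_posDef le_rfl hND] at hc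
    have hdet : N.det = 0 := by
      rw [hN.1.det_eq_prod_eigenvalues]
      exact Finset.prod_eq_zero (Finset.mem_univ k) (by simp [hk])
    have hcont : Continuous fun ε : ℝ =>
        (N + ε • (1 : Matrix (Fin p) (Fin p) ℝ)).det ^ (1 / (p : ℝ)) :=
      (Continuous.matrix_det (by fun_prop)).rpow_const fun _ => Or.inr (by positivity)
    have hev := (hcont.tendsto 0).eventually_lt_const (u := c) (by
      rw [zero_smul, add_zero, hdet, Real.zero_rpow (by positivity)]
      exact hc)
    obtain ⟨ε, hε, hlt⟩ := ((hev.filter_mono nhdsWithin_le_nhds).and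
      (self_mem_nhdsWithin (s := Set.Ioi (0 : ℝ)))).exists.imp fun _ h => h.symm
    exact ⟨ε, hε, by rwa [kieferPhi_zero (add_smul_one_posDef hN hε)]⟩
  · have hcont : Continuous fun ε : ℝ =>
        ((1 / (p : ℝ)) * ∑ i, (hN.1.eigenvalues i + ε) ^ q) ^ (1 / q) := by
      refine Continuous.rpow_const (continuous_const.mul (continuous_finsetSum _ fun i _ =>
        Continuous.rpow_const (by fun_prop) fun _ => Or.inr hq.le)) fun _ => Or.inr ?_
      positivity
    have hev := (hcont.tendsto 0).eventually_lt_const (u := c) (by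
      rw [kieferPhi_eq_rpow hq.ne' (Or.inr hq), trace_matPow hN.1] at hc
      simpa using hc)
    obtain ⟨ε, hε, hlt⟩ := ((hev.filter_mono nhdsWithin_le_nhds).and
      (self_mem_nhdsWithin (s := Set.Ioi (0 : ℝ)))).exists.imp fun _ h => h.symm
    refine ⟨ε, hε, ?_⟩
    rwa [kieferPhi_eq_rpow hq.ne' (Or.inr hq), matPow, trace_cfc_add_smul_one hN.1]

/-- Kiefer's criterion is an infimum of linear functions on nonnegative definite matrices. -/
lemma exists_linear_majorant (hp : 1 ≤ p) {q c : ℝ} (hq : q < 1)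
    {N : Matrix (Fin p) (Fin p) ℝ} (hN : N.PosSemidef) (hc : kieferPhi q N < c) :
    ∃ C : Matrix (Fin p) (Fin p) ℝ, (C * N).trace < c ∧
      ∀ N' : Matrix (Fin p) (Fin p) ℝ, N'.PosSemidef → kieferPhi q N' ≤ (C * N').trace := by
  have hp' : (0 : ℝ) < p := by exact_mod_cast hp
  -- M is N itself or N + εI. In the second case N ≤ M gives the trace inequality. The majorant is
  -- Hölder's at M.
  obtain ⟨M, hM, hlt, htr⟩ : ∃ M : Matrix (Fin p) (Fin p) ℝ, M.PosDef ∧ kieferPhi q M < c ∧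
      (matPow M (q - 1) * N).trace ≤ (matPow M q).trace := by
    by_cases hND : N.PosDef
    · exact ⟨N, hND, hc, by rw [matPow_mul_self hND]⟩
    · obtain ⟨ε, hε, hlt⟩ := exists_kieferPhi_add_smul_one_lt hp hN hND hc
      have hD := add_smul_one_posDef hN hε
      refine ⟨_, hD, hlt, ?_⟩
      have := trace_matPow_pos hp hD (q - 1)
      nth_rewrite 2 [← matPow_mul_self hD]
      rw [mul_add, trace_add, mul_smul_comm, mul_one, trace_smul, smul_eq_mul]
      have := mul_pos hε this
      linarith
  have hMp : 0 < kieferPhi q M := kieferPhi_pos hp hM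
  set k := (p * kieferPhi q M ^ (q - 1)) with hk
  have hk0 : 0 < k := mul_pos hp' (Real.rpow_pos_of_pos hMp _)
  refine ⟨k⁻¹ • matPow M (q - 1), ?_, fun N' hN' => ?_⟩
  · rw [smul_mul, trace_smul, smul_eq_mul]
    refine lt_of_le_of_lt ?_ hlt
    rw [inv_mul_le_iff₀ hk0]
    refine htr.trans_eq ?_
    rw [← kieferPhi_rpow hp hM.posSemidef (Or.inl hM), hk, mul_assoc, ← Real.rpow_add_one hMp.ne',
      sub_add_cancel]
  · rw [smul_mul, trace_smul, smul_eq_mul, le_inv_mul_iff₀ hk0]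
    exact kieferPhi_mul_le hp hq hM hN'

/-- An infimum of linear, not merely affine, functions is superlinear, so the weights need not sum
to 1. -/
lemma kieferPhi_concave (hp : 1 ≤ p) {q : ℝ} (hq : q < 1) {M N : Matrix (Fin p) (Fin p) ℝ}
    (hM : M.PosSemidef) (hN : N.PosSemidef) {a b : ℝ} (ha : 0 ≤ a) (hb : 0 ≤ b) :
    a * kieferPhi q M + b * kieferPhi q N ≤ kieferPhi q (a • M + b • N) := by
  by_contra! h
  obtain ⟨C, h1, h2⟩ := exists_linear_majorant hp hq ((hM.smul ha).add (hN.smul hb)) h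
  rw [mul_add, trace_add, mul_smul_comm, mul_smul_comm, trace_smul, trace_smul, smul_eq_mul,
    smul_eq_mul] at h1
  have := mul_le_mul_of_nonneg_left (h2 M hM) ha
  have := mul_le_mul_of_nonneg_left (h2 N hN) hb
  linarith

end

section

variable {p : ℕ}

/-! ### Traces against functions of a matrix -/

lemma le_trace_cfc_mul {M N : Matrix (Fin p) (Fin p) ℝ} (hM : M.IsHermitian)
    (hN : N.PosSemidef) {f g : ℝ → ℝ} (h : ∀ i, f (hM.eigenvalues i) ≤ g (hM.eigenvalues i)) :
    (cfc f M * N).trace ≤ (cfc g M * N).trace := by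
  rw [trace_cfc_mul hM hN.1, trace_cfc_mul hM hN.1]
  refine Finset.sum_le_sum fun i _ => Finset.sum_le_sum fun j _ => ?_
  exact mul_le_mul_of_nonneg_right (mul_le_mul_of_nonneg_right (h i) (hN.eigenvalues_nonneg j))
    (overlap_nonneg _ _ i j)

lemma trace_cfc_const_mul {M : Matrix (Fin p) (Fin p) ℝ} (hM : M.IsHermitian)
    (N : Matrix (Fin p) (Fin p) ℝ) (r : ℝ) :
    (cfc (fun _ : ℝ => r) M * N).trace = r * N.trace := by
  rw [show cfc (fun _ : ℝ => r) M = algebraMap ℝ _ r from cfc_const r M hM,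
    Algebra.algebraMap_eq_smul_one, smul_mul, one_mul, trace_smul, smul_eq_mul]

lemma mul_trace_le_trace_mul {M N : Matrix (Fin p) (Fin p) ℝ} (hM : M.IsHermitian)
    (hN : N.PosSemidef) {r : ℝ} (h : ∀ i, r ≤ hM.eigenvalues i) :
    r * N.trace ≤ (M * N).trace := by
  have := le_trace_cfc_mul hM hN (f := fun _ => r) (g := fun t => t) h
  rwa [trace_cfc_const_mul hM, show cfc (fun t : ℝ => t) M = M from cfc_id' ℝ M hM] at this

lemma trace_mul_vecMulVec (M : Matrix (Fin p) (Fin p) ℝ) (v : Fin p → ℝ) :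
    (M * vecMulVec v v).trace = v ⬝ᵥ M *ᵥ v := by
  rw [mul_vecMulVec, trace_vecMulVec, dotProduct_comm]

lemma vecMulVec_posSemidef (v : Fin p → ℝ) : (vecMulVec v v).PosSemidef := by
  simpa using posSemidef_vecMulVec_self_star v

lemma mul_dotProduct_le {M : Matrix (Fin p) (Fin p) ℝ} (hM : M.IsHermitian) {r : ℝ}
    (h : ∀ i, r ≤ hM.eigenvalues i) (v : Fin p → ℝ) : r * (v ⬝ᵥ v) ≤ v ⬝ᵥ M *ᵥ v := by
  have := mul_trace_le_trace_mul hM (vecMulVec_posSemidef v) h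
  rwa [trace_mul_vecMulVec, trace_vecMulVec] at this

lemma exists_unit_eigenvector {M : Matrix (Fin p) (Fin p) ℝ} (hM : M.IsHermitian) (i : Fin p) :
    ∃ v : Fin p → ℝ, v ⬝ᵥ v = 1 ∧ M *ᵥ v = hM.eigenvalues i • v := by
  refine ⟨(hM.eigenvectorBasis i).ofLp, ?_, hM.mulVec_eigenvectorBasis i⟩
  have h1 := hM.eigenvectorBasis.orthonormal.1 i
  have h2 : inner ℝ (hM.eigenvectorBasis i) (hM.eigenvectorBasis i) = (1 : ℝ) := by
    rw [real_inner_self_eq_norm_sq, h1, one_pow]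
  rw [← h2, EuclideanSpace.inner_eq_star_dotProduct]
  simp

lemma le_eigenvalues {M : Matrix (Fin p) (Fin p) ℝ} (hM : M.IsHermitian) {r : ℝ}
    (h : ∀ v : Fin p → ℝ, r * (v ⬝ᵥ v) ≤ v ⬝ᵥ M *ᵥ v) (i : Fin p) : r ≤ hM.eigenvalues i := by
  obtain ⟨v, h1, hv⟩ := exists_unit_eigenvector hM i
  have := h v
  rwa [hv, dotProduct_smul, h1, mul_one, smul_eq_mul, mul_one] at this

lemma exists_min_eigenvalue (hp : 1 ≤ p) {M : Matrix (Fin p) (Fin p) ℝ} (hM : M.IsHermitian) :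
    ∃ i, ∀ j, hM.eigenvalues i ≤ hM.eigenvalues j :=
  have : Nonempty (Fin p) := ⟨⟨0, hp⟩⟩
  Finite.exists_min _

lemma eigenvalues_le_trace {M : Matrix (Fin p) (Fin p) ℝ} (hM : M.PosSemidef) (i : Fin p) :
    hM.1.eigenvalues i ≤ M.trace := by
  rw [hM.1.trace_eq_sum_eigenvalues]
  exact Finset.single_le_sum (f := hM.1.eigenvalues) (fun i _ => hM.eigenvalues_nonneg i)
    (Finset.mem_univ i)

lemma trace_mul_nonneg {M N : Matrix (Fin p) (Fin p) ℝ} (hM : M.PosSemidef)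
    (hN : N.PosSemidef) : 0 ≤ (M * N).trace := by
  simpa using mul_trace_le_trace_mul hM.1 hN (r := 0) hM.eigenvalues_nonneg

/-- Continuity of `M ↦ trace (f (M) N)` along matrices with eigenvalues in a fixed interval. -/
lemma tendsto_trace_cfc_mul {ι : Type*} {l : Filter ι} {P : ι → Matrix (Fin p) (Fin p) ℝ}
    {M N : Matrix (Fin p) (Fin p) ℝ} (hP : Filter.Tendsto P l (nhds M)) (hN : N.PosSemidef)
    {a b : ℝ} {f : ℝ → ℝ} (hf : ContinuousOn f (Set.Icc a b))
    (hPab : ∀ᶠ t in l, ∃ h : (P t).IsHermitian, ∀ i, h.eigenvalues i ∈ Set.Icc a b)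
    (hM : M.IsHermitian) (hMab : ∀ i, hM.eigenvalues i ∈ Set.Icc a b) :
    Filter.Tendsto (fun t => (cfc f (P t) * N).trace) l (nhds (cfc f M * N).trace) := by
  rw [Metric.tendsto_nhds]
  intro ε hε
  have htr : 0 ≤ N.trace := hN.trace_nonneg
  -- Weierstrass approximation within δ changes each trace by at most δ tr N < ε/3; the added 1
  -- covers tr N = 0.
  set δ := ε / (3 * (N.trace + 1)) with hδ
  have hδ0 : 0 < δ := by positivity
  have hδε : δ * N.trace < ε / 3 := by
    rw [hδ, div_mul_eq_mul_div, div_lt_div_iff₀ (by positivity) (by norm_num)]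
    nlinarith
  obtain ⟨g, hg⟩ := exists_polynomial_near_of_continuousOn a b f hf δ hδ0
  have key : ∀ {K : Matrix (Fin p) (Fin p) ℝ} (hK : K.IsHermitian),
      (∀ i, hK.eigenvalues i ∈ Set.Icc a b) →
      |(cfc f K * N).trace - (Polynomial.aeval K g * N).trace| ≤ δ * N.trace := by
    intro K hK hi
    have e : cfc (fun t => g.eval t) K = Polynomial.aeval K g := cfc_polynomial g K hK
    have hdiff : (cfc f K * N).trace - (cfc (fun t => g.eval t) K * N).trace =
        (cfc (fun t => f t - g.eval t) K * N).trace := by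
      have : cfc (fun t => f t - g.eval t) K = cfc f K - cfc (fun t => g.eval t) K :=
        cfc_sub f _ K (K.finite_real_spectrum.continuousOn _)
          (K.finite_real_spectrum.continuousOn _)
      rw [this, sub_mul, trace_sub]
    rw [← e, hdiff, abs_le]
    have hb := fun i => abs_lt.1 (hg _ (hi i))
    constructor
    · have := le_trace_cfc_mul hK hN (f := fun _ => -δ) (g := fun t => f t - g.eval t)
        (fun i => by linarith [(hb i).2])
      rw [trace_cfc_const_mul hK] at this
      linarith
    · have := le_trace_cfc_mul hK hN (f := fun t => f t - g.eval t) (g := fun _ => δ)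
        (fun i => by linarith [(hb i).1])
      rwa [trace_cfc_const_mul hK] at this
  have hcont : Continuous fun K : Matrix (Fin p) (Fin p) ℝ =>
      (Polynomial.aeval K g * N).trace :=
    Continuous.matrix_trace ((Polynomial.continuous_aeval g).mul continuous_const)
  have hlim := Metric.tendsto_nhds.1 ((hcont.tendsto M).comp hP) (ε / 3) (by positivity)
  filter_upwards [hPab, hlim] with t ht ht2
  obtain ⟨hK, hKi⟩ := ht
  have k1 := abs_le.1 (key hK hKi)
  have k2 := abs_le.1 (key hM hMab)
  rw [Function.comp, Real.dist_eq, abs_lt] at ht2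
  rw [Real.dist_eq, abs_lt]
  constructor <;> linarith [k1.1, k1.2, k2.1, k2.2, ht2.1, ht2.2]

/-! ### Optimality along segments -/

/-- Hölder is applied at the intermediate matrix P, since M may be singular. It gives tr(P^q) ≤
tr(P^(q-1) M), and expanding P in P^q = P^(q-1) P leaves t times the claim. -/
lemma trace_le_of_kieferPhi_le (hp : 1 ≤ p) {q : ℝ} (hq : q < 1)
    {M N : Matrix (Fin p) (Fin p) ℝ} (hM : M.PosSemidef) {t : ℝ} (ht : 0 < t)
    (hD : ((1 - t) • M + t • N).PosDef)
    (hle : kieferPhi q ((1 - t) • M + t • N) ≤ kieferPhi q M) :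
    (matPow ((1 - t) • M + t • N) (q - 1) * N).trace ≤
      (matPow ((1 - t) • M + t • N) (q - 1) * M).trace := by
  have h1 := kieferPhi_mul_le hp hq hD hM
  have h2 := kieferPhi_rpow hp hD.posSemidef (Or.inl hD) (q := q)
  have hpos := kieferPhi_pos (q := q) hp hD
  have hmul := matPow_mul_self hD q
  set P := (1 - t) • M + t • N with hP
  have h3 : (matPow P q).trace ≤ (matPow P (q - 1) * M).trace := by
    refine le_trans ?_ h1
    rw [← h2, mul_assoc]
    refine mul_le_mul_of_nonneg_left ?_ (Nat.cast_nonneg p)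
    calc kieferPhi q P ^ q = kieferPhi q P ^ (q - 1) * kieferPhi q P := by
          rw [← Real.rpow_add_one hpos.ne', sub_add_cancel]
      _ ≤ _ := mul_le_mul_of_nonneg_left hle (Real.rpow_nonneg hpos.le _)
  rw [← hmul] at h3
  nth_rewrite 2 [hP] at h3
  rw [mul_add, trace_add, mul_smul_comm, mul_smul_comm, trace_smul, trace_smul, smul_eq_mul,
    smul_eq_mul] at h3
  refine le_of_mul_le_mul_left ?_ ht
  linarith

lemma rpow_le_one_add {q x : ℝ} (hq0 : 0 < q) (hq : q < 1) (hx : 0 ≤ x) : x ^ q ≤ 1 + x := by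
  have := rpow_one_add_le_one_add_mul_self (s := x - 1) (by linarith) hq0.le hq.le
  rw [add_sub_cancel] at this
  nlinarith

/-- For 0 < q a singular M has an infinite slope towards a definite N: a kernel vector of M forces
tr(P^(q-1)) to grow like t^(q-1). -/
lemma posDef_of_kieferPhi_le (hp : 1 ≤ p) {q : ℝ} (hq : q < 1)
    {M N : Matrix (Fin p) (Fin p) ℝ} (hM : M.PosSemidef) (hN : N.PosDef)
    (h : ∀ t : ℝ, 0 < t → t < 1 → kieferPhi q ((1 - t) • M + t • N) ≤ kieferPhi q M) :
    M.PosDef := by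
  by_contra hMD
  have hD : ∀ t : ℝ, 0 < t → t < 1 → ((1 - t) • M + t • N).PosDef := fun t h0 h1 =>
    PosDef.posSemidef_add (hM.smul (by linarith)) (hN.smul h0)
  rcases le_or_gt q 0 with hq0 | hq0
  · have h1 := h (1 / 2) (by norm_num) (by norm_num)
    rw [kieferPhi_of_not_posDef hq0 hMD] at h1
    exact h1.not_gt (kieferPhi_pos hp (hD _ (by norm_num) (by norm_num)))
  obtain ⟨k, hk⟩ : ∃ k, hM.1.eigenvalues k = 0 := by
    by_contra! h
    exact hMD (hM.1.posDef_iff_eigenvalues_pos.2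
      fun i => (hM.eigenvalues_nonneg i).lt_of_ne' (h i))
  obtain ⟨u, hu1, huM⟩ := exists_unit_eigenvector hM.1 k
  rw [hk, zero_smul] at huM
  have hu0 : u ≠ 0 := by
    rintro rfl
    simp at hu1
  have hc : 0 < u ⬝ᵥ N *ᵥ u := by simpa using hN.dotProduct_mulVec_pos hu0
  set c := u ⬝ᵥ N *ᵥ u with hcdef
  obtain ⟨i0, hi0⟩ := exists_min_eigenvalue hp hN.1
  have ha := hN.eigenvalues_pos i0
  set a := hN.1.eigenvalues i0 with hadef
  have hMtr := hM.trace_nonneg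
  have hNtr := hN.posSemidef.trace_nonneg
  -- Here c is the value of N on the kernel vector and a the least eigenvalue of N. Multiplying by
  -- (tc)^(1-q) removes the blow-up, and t → 0 leaves a ≤ 0.
  have key : ∀ t : ℝ, 0 < t → t < 1 →
      a * (1 - t) ≤ (p + (M.trace + N.trace)) * (t * c) ^ (1 - q) := by
    intro t h0 h1
    have hPD := hD t h0 h1
    have hle := trace_le_of_kieferPhi_le hp hq hM h0 hPD (h t h0 h1)
    have hmul := matPow_mul_self hPD q
    have hPu : u ⬝ᵥ ((1 - t) • M + t • N) *ᵥ u = t * c := by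
      rw [add_mulVec, smul_mulVec, smul_mulVec, huM, smul_zero, zero_add, dotProduct_smul,
        smul_eq_mul]
    have hPtr : ((1 - t) • M + t • N).trace ≤ M.trace + N.trace := by
      rw [trace_add, trace_smul, trace_smul, smul_eq_mul, smul_eq_mul]
      nlinarith
    set P := (1 - t) • M + t • N with hP
    obtain ⟨i, hi⟩ := exists_min_eigenvalue hp hPD.1
    have hiu := mul_dotProduct_le hPD.1 hi u
    rw [hu1, mul_one, hPu] at hiu
    have htc : 0 < t * c := mul_pos h0 hc
    have e1 : (t * c) ^ (q - 1) ≤ (matPow P (q - 1)).trace := by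
      rw [trace_matPow hPD.1]
      refine (Real.rpow_le_rpow_of_nonpos (hPD.eigenvalues_pos i) hiu (by linarith)).trans ?_
      exact Finset.single_le_sum (f := fun i => hPD.1.eigenvalues i ^ (q - 1))
        (fun i _ => Real.rpow_nonneg (hPD.eigenvalues_pos i).le _) (Finset.mem_univ i)
    have e2 : a * (matPow P (q - 1)).trace ≤ (matPow P (q - 1) * N).trace := by
      rw [trace_mul_comm]
      exact mul_trace_le_trace_mul hN.1 (matPow_posDef hPD _).posSemidef hi0
    have e3 : (1 - t) * (matPow P (q - 1) * M).trace ≤ (matPow P q).trace := by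
      have e4 : 0 ≤ (matPow P (q - 1) * N).trace :=
        trace_mul_nonneg (matPow_posDef hPD _).posSemidef hN.posSemidef
      rw [← hmul]
      nth_rewrite 3 [hP]
      rw [mul_add, trace_add, mul_smul_comm, mul_smul_comm, trace_smul, trace_smul, smul_eq_mul,
        smul_eq_mul]
      nlinarith
    have e5 : (matPow P q).trace ≤ p + (M.trace + N.trace) := by
      refine le_trans ?_ (add_le_add_right hPtr _)
      rw [trace_matPow hPD.1, hPD.1.trace_eq_sum_eigenvalues]
      calc _ ≤ ∑ i, (1 + hPD.1.eigenvalues i) := Finset.sum_le_sum fun i _ =>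
            rpow_le_one_add hq0 hq (hPD.eigenvalues_pos i).le
        _ = _ := by
            rw [Finset.sum_add_distrib]
            simp
    have e6 : (1 - t) * (a * (t * c) ^ (q - 1)) ≤ p + (M.trace + N.trace) := by
      refine le_trans ?_ (e3.trans e5)
      refine mul_le_mul_of_nonneg_left ?_ (by linarith)
      exact (mul_le_mul_of_nonneg_left e1 ha.le).trans (e2.trans hle)
    have hpow : (t * c) ^ (q - 1) * (t * c) ^ (1 - q) = 1 := by
      rw [← Real.rpow_add htc]
      simp
    calc a * (1 - t) = (1 - t) * (a * (t * c) ^ (q - 1)) * (t * c) ^ (1 - q) := by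
          rw [mul_assoc, mul_assoc, hpow]
          ring
      _ ≤ _ := mul_le_mul_of_nonneg_right e6 (Real.rpow_nonneg htc.le _)
  have hl : Continuous fun t : ℝ => a * (1 - t) := by fun_prop
  have hr : Continuous fun t : ℝ => (p + (M.trace + N.trace)) * (t * c) ^ (1 - q) :=
    continuous_const.mul (Continuous.rpow_const (by fun_prop) fun _ => Or.inr (by linarith))
  have hlim := le_of_tendsto_of_tendsto (b := nhdsWithin (0 : ℝ) (Set.Ioi 0))
    ((hl.tendsto 0).mono_left nhdsWithin_le_nhds) ((hr.tendsto 0).mono_left nhdsWithin_le_nhds) (by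
      filter_upwards [Ioo_mem_nhdsGT (zero_lt_one' ℝ)] with t ht
      exact key t ht.1 ht.2)
  rw [zero_mul, Real.zero_rpow (by linarith), mul_zero, sub_zero, mul_one] at hlim
  exact hlim.not_gt ha

lemma trace_matPow_le_of_kieferPhi_le (hp : 1 ≤ p) {q : ℝ} (hq : q < 1)
    {M N : Matrix (Fin p) (Fin p) ℝ} (hM : M.PosDef) (hN : N.PosSemidef)
    (h : ∀ t : ℝ, 0 < t → t < 1 → kieferPhi q ((1 - t) • M + t • N) ≤ kieferPhi q M) :
    (matPow M (q - 1) * N).trace ≤ (matPow M q).trace := by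
  have hD : ∀ t : ℝ, 0 < t → t < 1 → ((1 - t) • M + t • N).PosDef := fun t h0 h1 =>
    PosDef.add_posSemidef (hM.smul (by linarith)) (hN.smul h0.le)
  obtain ⟨i0, hi0⟩ := exists_min_eigenvalue hp hM.1
  have hr := hM.eigenvalues_pos i0
  set r := hM.1.eigenvalues i0 with hrdef
  have hMtr := hM.posSemidef.trace_nonneg
  have hNtr := hN.trace_nonneg
  -- For t < 1/2 the eigenvalues of P are at least (1 - t) r ≥ r/2, away from the singularity of the
  -- power at 0.
  have hf : ContinuousOn (fun x : ℝ => x ^ (q - 1)) (Set.Icc (r / 2) (M.trace + N.trace)) :=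
    fun x hx => (Real.continuousAt_rpow_const x _ (Or.inl (by
      have := hx.1
      linarith))).continuousWithinAt
  have hP : Filter.Tendsto (fun t : ℝ => (1 - t) • M + t • N)
      (nhdsWithin (0 : ℝ) (Set.Ioi 0)) (nhds M) := by
    have hc : Continuous fun t : ℝ => (1 - t) • M + t • N := by fun_prop
    have := (hc.tendsto 0).mono_left (nhdsWithin_le_nhds (s := Set.Ioi 0))
    simpa using this
  have hMab : ∀ i, hM.1.eigenvalues i ∈ Set.Icc (r / 2) (M.trace + N.trace) := fun i =>
    ⟨by linarith [hi0 i], by linarith [eigenvalues_le_trace hM.posSemidef i]⟩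
  have hPab : ∀ᶠ t in nhdsWithin (0 : ℝ) (Set.Ioi 0), ∃ h : ((1 - t) • M + t • N).IsHermitian,
      ∀ i, h.eigenvalues i ∈ Set.Icc (r / 2) (M.trace + N.trace) := by
    filter_upwards [Ioo_mem_nhdsGT (show (0 : ℝ) < 1 / 2 by norm_num)] with t ht
    have hPD := hD t ht.1 (by linarith [ht.2])
    refine ⟨hPD.1, fun i => ⟨le_eigenvalues hPD.1 (fun v => ?_) i, ?_⟩⟩
    · rw [add_mulVec, smul_mulVec, smul_mulVec, dotProduct_add, dotProduct_smul, dotProduct_smul,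
        smul_eq_mul, smul_eq_mul]
      have e1 := mul_dotProduct_le hM.1 hi0 v
      have e2 : 0 ≤ v ⬝ᵥ N *ᵥ v := by simpa using hN.dotProduct_mulVec_nonneg v
      have e3 : 0 ≤ v ⬝ᵥ v := by simpa using dotProduct_star_self_nonneg v
      have e4 := mul_nonneg ht.1.le e2
      have e5 := mul_le_mul_of_nonneg_left e1 (show 0 ≤ 1 - t by linarith [ht.2])
      have e6 := mul_nonneg hr.le e3
      have e7 := mul_nonneg (show 0 ≤ 1 / 2 - t by linarith [ht.2]) e6
      nlinarith
    · refine (eigenvalues_le_trace hPD.posSemidef i).trans ?_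
      rw [trace_add, trace_smul, trace_smul, smul_eq_mul, smul_eq_mul]
      nlinarith [ht.1, ht.2]
  have hlim := le_of_tendsto_of_tendsto
    (tendsto_trace_cfc_mul hP hN hf hPab hM.1 hMab)
    (tendsto_trace_cfc_mul hP hM.posSemidef hf hPab hM.1 hMab) (by
      filter_upwards [Ioo_mem_nhdsGT (zero_lt_one' ℝ)] with t ht
      exact trace_le_of_kieferPhi_le hp hq hM.posSemidef ht.1 (hD t ht.1 ht.2) (h t ht.1 ht.2))
  have := matPow_mul_self hM q
  rw [← this]
  exact hlim

end

/-! ### Convex hulls in finite dimension -/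

section ConvexHull

variable {E : Type*} [NormedAddCommGroup E] [NormedSpace ℝ E] [FiniteDimensional ℝ E]

/-- By Carathéodory, dim E + 1 points always suffice, so the hull is a continuous image of simplex ×
K^(dim E + 1). -/
lemma isCompact_convexHull {K : Set E} (hK : IsCompact K) : IsCompact (convexHull ℝ K) := by
  set m := Module.finrank ℝ E + 1 with hm
  have hc : Continuous fun wz : (Fin m → ℝ) × (Fin m → E) => ∑ i, wz.1 i • wz.2 i := by
    fun_prop
  have himg := ((isCompact_stdSimplex ℝ (Fin m)).prod
    (isCompact_univ_pi fun _ : Fin m => hK)).image hc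
  convert himg
  ext x
  constructor
  · intro hx
    obtain ⟨ι, hι, z, w, hz, haff, hw, hw1, hx⟩ := eq_pos_convex_span_of_mem_convexHull hx
    have hcard : Fintype.card ι ≤ m :=
      haff.card_le_finrank_succ.trans (Nat.succ_le_succ (Submodule.finrank_le _))
    obtain ⟨e⟩ : Nonempty (ι ↪ Fin m) :=
      Function.Embedding.nonempty_of_card_le (by simpa using hcard)
    have hne : Nonempty ι := by
      by_contra hne
      rw [not_nonempty_iff] at hne
      simp at hw1
    obtain ⟨i0⟩ := hne
    -- Unused slots get weight 0 and the repeated point z i0, which keeps them in K.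
    have hW : ∀ i, Function.extend e w 0 (e i) = w i := e.injective.extend_apply _ _
    have hW' : ∀ j ∉ Set.range e, Function.extend e w 0 j = 0 := fun j hj =>
      Function.extend_apply' _ _ _ hj
    have hZ : ∀ i, Function.extend e z (fun _ => z i0) (e i) = z i := e.injective.extend_apply _ _
    have hZ' : ∀ j ∉ Set.range e, Function.extend e z (fun _ => z i0) j = z i0 := fun j hj =>
      Function.extend_apply' _ _ _ hj
    generalize Function.extend e w 0 = W at hW hW'
    generalize Function.extend e z (fun _ => z i0) = Z at hZ hZ'
    refine ⟨(W, Z), ⟨⟨fun j => ?_, ?_⟩, fun j _ => ?_⟩, ?_⟩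
    · by_cases hj : j ∈ Set.range e
      · obtain ⟨i, rfl⟩ := hj
        exact (hw i).le.trans_eq (hW i).symm
      · exact (hW' j hj).ge
    · rw [← hw1]
      exact (Fintype.sum_of_injective e e.injective _ _ hW' fun i => (hW i).symm).symm
    · by_cases hj : j ∈ Set.range e
      · obtain ⟨i, rfl⟩ := hj
        exact Set.mem_of_eq_of_mem (hZ i) (hz ⟨i, rfl⟩)
      · exact Set.mem_of_eq_of_mem (hZ' j hj) (hz ⟨i0, rfl⟩)
    · rw [← hx]
      refine (Fintype.sum_of_injective e e.injective _ _ (fun j hj => ?_) fun i => ?_).symm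
      · simp only [hW' j hj, zero_smul]
      · simp only [hW, hZ]
  · rintro ⟨⟨w, z⟩, ⟨hw, hz⟩, rfl⟩
    exact mem_convexHull_of_exists_fintype w z hw.1 hw.2 (fun i => hz i trivial) rfl

end ConvexHull

/-- Carathéodory's theorem for points on a hyperplane avoiding the origin. -/
lemma exists_atomic_of_mem_convexHull {T V : Type*} [AddCommGroup V] [Module ℝ V]
    [FiniteDimensional ℝ V] {v : T → V} {s : Set T} (ℓ : V →ₗ[ℝ] ℝ) (hℓ : ∀ x ∈ s, ℓ (v x) = 1)
    {P : V} (hP : P ∈ convexHull ℝ (v '' s)) :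
    ∃ (S : Finset T) (w : T → ℝ), (∀ x ∈ S, 0 < w x) ∧ (∀ x ∈ S, x ∈ s) ∧
      P = ∑ x ∈ S, w x • v x ∧ S.card ≤ Module.finrank ℝ V := by
  classical
  obtain ⟨ι, hι, z, w, hz, haff, hw, hw1, hx⟩ := eq_pos_convex_span_of_mem_convexHull hP
  choose g hgs hgz using fun i => hz ⟨i, rfl⟩
  have hz1 : ∀ i, ℓ (z i) = 1 := fun i => by rw [← hgz i, hℓ _ (hgs i)]
  -- On the hyperplane ℓ = 1, affine independence is linear independence, which saves the extra
  -- point in Carathéodory's bound.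
  have hlin : LinearIndependent ℝ z := by
    rw [Fintype.linearIndependent_iff]
    intro c hc i
    refine affineIndependent_iff.1 haff Finset.univ c ?_ hc i (Finset.mem_univ i)
    have := congrArg ℓ hc
    simpa [map_sum, hz1] using this
  have hginj : Function.Injective g := fun i j hij => haff.injective (by rw [← hgz, ← hgz, hij])
  refine ⟨Finset.univ.image g, Function.extend g w 0, ?_, ?_, ?_, ?_⟩
  · intro x hxS
    obtain ⟨i, -, rfl⟩ := Finset.mem_image.1 hxS
    rw [hginj.extend_apply]
    exact hw i
  · intro x hxS
    obtain ⟨i, -, rfl⟩ := Finset.mem_image.1 hxS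
    exact hgs i
  · rw [Finset.sum_image hginj.injOn, ← hx]
    exact Finset.sum_congr rfl fun i _ => by rw [hginj.extend_apply, hgz]
  · rw [Finset.card_image_of_injective _ hginj, Finset.card_univ]
    exact hlin.fintype_card_le_finrank

/-! ### Moments -/

section Moments

variable {n d p : ℕ}

/-- The slack d - |α| as an extra coordinate turns these into (n+1)-tuples with sum exactly d. -/
lemma card_multiIdx (n d : ℕ) : Fintype.card (MultiIdx n d) = (n + d).choose n := by
  have h := Finset.card_finsuppAntidiag_nat_eq_choose (s := (Finset.univ : Finset (Fin (n + 1)))) d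
  rw [Finset.card_univ, Fintype.card_fin, add_right_comm, Nat.add_sub_cancel,
    ← Nat.choose_symm_add] at h
  rw [← h, ← Finset.card_univ]
  refine Finset.card_bij (fun α _ => Finsupp.cons (d - α.1.degree) α.1) ?_ ?_ ?_
  · rintro ⟨α, hα⟩ -
    rw [Finset.mem_finsuppAntidiag]
    refine ⟨?_, Finset.subset_univ _⟩
    rw [Fin.sum_univ_succ, Finsupp.cons_zero]
    simp only [Finsupp.cons_succ]
    rw [← Finsupp.degree_eq_sum, Nat.sub_add_cancel hα]
  · rintro α - β - hαβ
    have := congrArg Finsupp.tail hαβ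
    rw [Finsupp.tail_cons, Finsupp.tail_cons] at this
    exact Subtype.ext this
  · intro f hf
    rw [Finset.mem_finsuppAntidiag, Fin.sum_univ_succ] at hf
    have ht : (Finsupp.tail f).degree = ∑ i : Fin n, f i.succ := by
      rw [Finsupp.degree_eq_sum]
      rfl
    refine ⟨⟨Finsupp.tail f, by rw [ht]; omega⟩, Finset.mem_univ _, ?_⟩
    have h0 : d - (Finsupp.tail f).degree = f 0 := by rw [ht]; omega
    change Finsupp.cons (d - (Finsupp.tail f).degree) (Finsupp.tail f) = f
    rw [h0, Finsupp.cons_tail]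

lemma monomialVec_zero (k : ℕ) (x : Fin n → ℝ) : monomialVec k x (MultiIdx.zero n k) = 1 := by
  simp [monomialVec, MultiIdx.zero]

lemma monomialVec_add (x : Fin n → ℝ) (α β : MultiIdx n d) :
    monomialVec (2 * d) x (α.add β) = monomialVec d x α * monomialVec d x β := by
  simp only [monomialVec, MultiIdx.add, Finsupp.add_apply, pow_add, Finset.prod_mul_distrib]

lemma continuous_monomialVec (k : ℕ) : Continuous (monomialVec (n := n) k) := by
  unfold monomialVec
  fun_prop

/-- The information matrix as a linear function of the moments. -/
def infoMatrixLin (A : Matrix (Fin p) (MultiIdx n d) ℝ) :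
    (MultiIdx n (2 * d) → ℝ) →ₗ[ℝ] Matrix (Fin p) (Fin p) ℝ where
  toFun := infoMatrix A
  map_add' y z := by
    have : momentMatrix (y + z) = momentMatrix y + momentMatrix z := rfl
    rw [infoMatrix, this, Matrix.mul_add, Matrix.add_mul]
    rfl
  map_smul' c y := by
    have : momentMatrix (c • y) = c • momentMatrix y := rfl
    rw [infoMatrix, this, Matrix.mul_smul, Matrix.smul_mul]
    rfl

lemma infoMatrix_monomialVec (A : Matrix (Fin p) (MultiIdx n d) ℝ) (x : Fin n → ℝ) :
    infoMatrix A (monomialVec (2 * d) x) = vecMulVec (regressor A x) (regressor A x) := by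
  have h : momentMatrix (monomialVec (2 * d) x) =
      vecMulVec (monomialVec d x) (monomialVec d x) := by
    ext α β
    exact monomialVec_add x α β
  rw [infoMatrix, h, mul_vecMulVec, vecMulVec_mul, vecMul_transpose]
  rfl

lemma infoMatrix_sum {ι : Type*} (A : Matrix (Fin p) (MultiIdx n d) ℝ) (S : Finset ι)
    (w : ι → ℝ) (x : ι → Fin n → ℝ) :
    infoMatrix A (∑ i ∈ S, w i • monomialVec (2 * d) (x i)) =
      ∑ i ∈ S, w i • vecMulVec (regressor A (x i)) (regressor A (x i)) := by
  change infoMatrixLin A _ = _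
  rw [map_sum]
  refine Finset.sum_congr rfl fun i _ => ?_
  rw [map_smul]
  exact congrArg _ (infoMatrix_monomialVec A (x i))

lemma atomicMoments_eq_sum (k : ℕ) (S : Finset (Fin n → ℝ)) (w : (Fin n → ℝ) → ℝ) :
    atomicMoments k S w = ∑ x ∈ S, w x • monomialVec k x := by
  ext γ
  simp [atomicMoments]

lemma infoMatrix_posSemidef (A : Matrix (Fin p) (MultiIdx n d) ℝ) {X : Set (Fin n → ℝ)}
    {y : MultiIdx n (2 * d) → ℝ} (hy : y ∈ convexHull ℝ (monomialVec (2 * d) '' X)) :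
    (infoMatrix A y).PosSemidef := by
  have hconv : Convex ℝ {y : MultiIdx n (2 * d) → ℝ | (infoMatrixLin A y).PosSemidef} := by
    intro y hy z hz a b ha hb _
    simp only [Set.mem_ofPred_eq, map_add, map_smul] at *
    exact (hy.smul ha).add (hz.smul hb)
  refine convexHull_min ?_ hconv hy
  rintro _ ⟨x, -, rfl⟩
  change (infoMatrix A _).PosSemidef
  rw [infoMatrix_monomialVec]
  exact vecMulVec_posSemidef _

lemma infoMatrix_atomicMoments (A : Matrix (Fin p) (MultiIdx n d) ℝ)
    (S : Finset (Fin n → ℝ)) (w : (Fin n → ℝ) → ℝ) :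
    infoMatrix A (atomicMoments (2 * d) S w) =
      ∑ x ∈ S, w x • vecMulVec (regressor A x) (regressor A x) := by
  rw [atomicMoments_eq_sum]
  exact infoMatrix_sum A S w id

/-- The semidefinite constraint is automatic: information matrices of designs are nonnegative sums
of rank-one squares. -/
lemma designFeasible_eq_convexHull (A : Matrix (Fin p) (MultiIdx n d) ℝ) (X : Set (Fin n → ℝ)) :
    designFeasible A X = convexHull ℝ (monomialVec (2 * d) '' X) := by
  ext y
  constructor
  · rintro ⟨-, l, x, w, hx, hw, hy⟩
    refine mem_convexHull_of_exists_fintype w (fun i => monomialVec (2 * d) (x i)) hw.1 hw.2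
      (fun i => ⟨x i, hx i, rfl⟩) ?_
    ext γ
    simp [hy γ]
  · intro hy
    refine ⟨infoMatrix_posSemidef A hy, ?_⟩
    obtain ⟨ι, hι, w, z, hw, hw1, hz, hy⟩ := mem_convexHull_iff_exists_fintype.1 hy
    choose x hx hxz using hz
    let e := (Fintype.equivFin ι).symm
    refine ⟨Fintype.card ι, x ∘ e, w ∘ e, fun i => hx _, ⟨fun i => hw _, ?_⟩, fun γ => ?_⟩
    · rw [← hw1]
      exact e.sum_comp w
    · rw [← hy, Finset.sum_apply, ← e.sum_comp]
      exact Finset.sum_congr rfl fun i _ => by simp [hxz]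

lemma convexHull_subset_normalizedMoments (k : ℕ) {X : Set (Fin n → ℝ)}
    (hX : MeasurableSet X) : convexHull ℝ (monomialVec k '' X) ⊆ normalizedMoments k X := by
  intro y hy
  obtain ⟨ι, hι, w, z, hw, hw1, hz, hy⟩ := mem_convexHull_iff_exists_fintype.1 hy
  choose x hx hxz using hz
  have hy' : ∀ γ, y γ = ∑ i, w i * monomialVec k (x i) γ := fun γ => by
    rw [← hy, Finset.sum_apply]
    exact Finset.sum_congr rfl fun i _ => by simp [hxz]
  set μ : Measure (Fin n → ℝ) := ∑ i, ENNReal.ofReal (w i) • Measure.dirac (x i) with hμ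
  have hμX : μ Xᶜ = 0 := by
    simp [hμ, Measure.finsetSum_apply, Measure.dirac_apply' _ hX.compl, hx]
  have hfin : ∀ i, IsFiniteMeasure (ENNReal.ofReal (w i) • Measure.dirac (x i)) := fun i =>
    Measure.smul_finite _ ENNReal.ofReal_ne_top
  have hμf : IsFiniteMeasure μ := ⟨by
    rw [hμ, Measure.finsetSum_apply]
    exact ENNReal.sum_lt_top.2 fun i _ => measure_lt_top _ _⟩
  refine ⟨⟨μ, hμf, hμX, fun γ => ?_⟩, ?_⟩
  · rw [Measure.restrict_eq_self_of_ae_mem (mem_ae_iff.2 hμX), hy' γ, hμ,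
      integral_finsetSum_measure]
    · refine Finset.sum_congr rfl fun i _ => ?_
      rw [integral_smul_measure, integral_dirac, ENNReal.toReal_ofReal (hw i), smul_eq_mul]
    · intro i _
      exact Integrable.smul_measure (integrable_dirac (by simp)) ENNReal.ofReal_ne_top
  · rw [hy']
    simp [monomialVec_zero, hw1]

/-- The condition y_0 = 1 makes the restricted measure a probability, and y is its barycentre. -/
lemma normalizedMoments_subset_convexHull (k : ℕ) {X : Set (Fin n → ℝ)} (hX : IsCompact X) :
    normalizedMoments k X ⊆ convexHull ℝ (monomialVec k '' X) := by
  rintro y ⟨⟨μ, hμ, -, hy⟩, hy0⟩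
  have hcpt := isCompact_convexHull (hX.image (continuous_monomialVec (n := n) k))
  have hprob : IsProbabilityMeasure (μ.restrict X) := by
    have h1 := hy (MultiIdx.zero n k)
    rw [hy0] at h1
    simp only [monomialVec_zero, integral_const, smul_eq_mul, mul_one] at h1
    exact ⟨by
      rw [measureReal_def] at h1
      exact (ENNReal.toReal_eq_one_iff _).1 h1.symm⟩
  have hint : ∀ γ, Integrable (fun x => monomialVec k x γ) (μ.restrict X) := fun γ =>
    ContinuousOn.integrableOn_compact hX
      ((continuous_pi_iff.1 (continuous_monomialVec (n := n) k) γ).continuousOn)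
  have hyint : y = ∫ x, monomialVec k x ∂(μ.restrict X) := by
    ext γ
    rw [hy γ, eval_integral hint γ]
  rw [hyint]
  refine (convex_convexHull ℝ _).integral_mem hcpt.isClosed ?_ (Integrable.of_eval hint)
  filter_upwards [ae_restrict_mem hX.measurableSet] with x hx
  exact subset_convexHull ℝ _ ⟨x, hx, rfl⟩

end Moments

section

variable {n d p : ℕ}

/-! ### Information matrices -/

lemma mulVec_injective_of_rank_eq {m k : Type*} [Fintype m] [Fintype k] [DecidableEq k]
    {B : Matrix m k ℝ} (h : B.rank = Fintype.card k) : Function.Injective B.mulVec := by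
  have h1 := LinearMap.finrank_range_add_finrank_ker B.mulVecLin
  rw [Module.finrank_fintype_fun_eq_card] at h1
  change B.rank + _ = _ at h1
  have h2 : Module.finrank ℝ B.mulVecLin.ker = 0 := by omega
  exact LinearMap.ker_eq_bot.1 (Submodule.finrank_eq_zero.1 h2)

lemma eq_zero_of_mul_eq_zero {m k l : Type*} [Fintype k]
    {B : Matrix m k ℝ} (h : Function.Injective B.mulVec) {D : Matrix k l ℝ} (hD : B * D = 0) :
    D = 0 := by
  ext i j
  have h1 : B *ᵥ (fun i => D i j) = B *ᵥ 0 := by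
    rw [mulVec_zero]
    ext r
    exact congrFun (congrFun hD r) j
  exact congrFun (h h1) i

/-- The regression functions are linearly independent on a set with nonempty interior. -/
lemma eq_zero_of_dotProduct_regressor {A : Matrix (Fin p) (MultiIdx n d) ℝ} (hA : A.rank = p)
    {X : Set (Fin n → ℝ)} (hX : (interior X).Nonempty) {c : Fin p → ℝ}
    (hc : ∀ x ∈ X, c ⬝ᵥ regressor A x = 0) : c = 0 := by
  classical
  set P : MvPolynomial (Fin n) ℝ := ∑ α : MultiIdx n d, MvPolynomial.monomial α.1 ((Aᵀ *ᵥ c) α)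
    with hP
  have hev : ∀ x, MvPolynomial.eval x P = c ⬝ᵥ regressor A x := by
    intro x
    rw [regressor, dotProduct_mulVec, ← mulVec_transpose, hP, map_sum, dotProduct]
    refine Finset.sum_congr rfl fun α _ => ?_
    rw [MvPolynomial.eval_monomial, Finsupp.prod_fintype _ _ (fun i => pow_zero _)]
    rfl
  obtain ⟨x0, hx0⟩ := hX
  obtain ⟨ε, hε, hball⟩ := Metric.isOpen_iff.1 isOpen_interior x0 hx0
  -- A sup-norm ball is a product of infinite sets, on which only the zero polynomial vanishes.
  have hP0 : P = 0 := by
    refine MvPolynomial.funext_set (fun i => Metric.ball (x0 i) ε)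
      (fun i => infinite_of_mem_nhds (x0 i) (Metric.ball_mem_nhds _ hε)) fun x hx => ?_
    rw [hev, map_zero]
    refine hc x (interior_subset (hball ?_))
    rw [ball_pi _ hε]
    exact hx
  have hcoef : Aᵀ *ᵥ c = Aᵀ *ᵥ 0 := by
    rw [mulVec_zero]
    ext α
    have h := congrArg (MvPolynomial.coeff α.1) hP0
    rw [hP, MvPolynomial.coeff_sum, Finset.sum_eq_single α] at h
    · simpa using h
    · intro β _ hβ
      rw [MvPolynomial.coeff_monomial, if_neg fun h => hβ (Subtype.ext h)]
    · simp
  exact mulVec_injective_of_rank_eq (by rw [rank_transpose, hA, Fintype.card_fin]) hcoef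

lemma dotProduct_sum_vecMulVec {ι : Type*} (S : Finset ι) (w : ι → ℝ) (f : ι → Fin p → ℝ)
    (c : Fin p → ℝ) :
    c ⬝ᵥ (∑ i ∈ S, w i • vecMulVec (f i) (f i)) *ᵥ c = ∑ i ∈ S, w i * (c ⬝ᵥ f i) ^ 2 := by
  rw [sum_mulVec, dotProduct_sum]
  refine Finset.sum_congr rfl fun i _ => ?_
  rw [smul_mulVec, dotProduct_smul, vecMulVec_mulVec, smul_eq_mul]
  rw [dotProduct_smul, op_smul_eq_smul, smul_eq_mul, dotProduct_comm (f i) c, sq]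

/-- A functional killing all F(x) would be a linear relation between the regressors, so these
vectors span; a uniform design on a finite spanning set works. -/
lemma exists_posDef_infoMatrix (hp : 1 ≤ p) {A : Matrix (Fin p) (MultiIdx n d) ℝ}
    (hA : A.rank = p) {X : Set (Fin n → ℝ)} (hX : (interior X).Nonempty) :
    ∃ y ∈ convexHull ℝ (monomialVec (2 * d) '' X), (infoMatrix A y).PosDef := by
  classical
  have hspan : Submodule.span ℝ (regressor A '' X) = ⊤ := by
    by_contra hne
    obtain ⟨f, hf0, hf⟩ := Submodule.exists_le_ker_of_lt_top _ (lt_top_iff_ne_top.2 hne)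
    apply hf0
    have hfd : ∀ v, f v = (fun i => f (Pi.single i 1)) ⬝ᵥ v := fun v => by
      conv_lhs => rw [pi_eq_sum_univ' v, map_sum]
      simp [dotProduct, mul_comm]
    have hz := eq_zero_of_dotProduct_regressor hA hX (c := fun i => f (Pi.single i 1))
      fun x hx => by
        rw [← hfd]
        exact hf (Submodule.subset_span ⟨x, hx, rfl⟩)
    ext v
    simpa using congrFun hz v
  obtain ⟨S, hS, hSspan⟩ := (Submodule.fg_span_iff_fg_span_finset_subset (R := ℝ)
    (regressor A '' X)).1 (IsNoetherian.noetherian _)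
  rw [hspan] at hSspan
  choose g hgX hg using fun s : S => hS s.2
  have hcard : 0 < (Fintype.card S : ℝ) := by
    rw [Nat.cast_pos, Fintype.card_pos_iff]
    by_contra hne
    rw [not_nonempty_iff, Finset.isEmpty_coe_sort] at hne
    rw [hne, Finset.coe_empty, Submodule.span_empty] at hSspan
    have := congrArg (fun K : Submodule ℝ (Fin p → ℝ) => Module.finrank ℝ K) hSspan
    simp at this
    omega
  set k := (Fintype.card S : ℝ) with hk
  have hy : (∑ s : S, k⁻¹ • monomialVec (2 * d) (g s)) ∈
      convexHull ℝ (monomialVec (2 * d) '' X) := by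
    refine mem_convexHull_of_exists_fintype (fun _ => k⁻¹) (fun s => monomialVec (2 * d) (g s))
      (fun _ => (inv_pos.2 hcard).le) ?_ (fun s => ⟨g s, hgX s, rfl⟩) rfl
    rw [Finset.sum_const, Finset.card_univ, nsmul_eq_mul, ← hk, mul_inv_cancel₀ hcard.ne']
  refine ⟨_, hy, ?_⟩
  refine PosDef.of_dotProduct_mulVec_pos (infoMatrix_posSemidef A hy).1 fun c hc => ?_
  rw [star_trivial, infoMatrix_sum, dotProduct_sum_vecMulVec]
  by_contra hle
  have hnn : ∀ s ∈ (Finset.univ : Finset S), 0 ≤ k⁻¹ * (c ⬝ᵥ regressor A (g s)) ^ 2 :=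
    fun s _ => mul_nonneg (inv_pos.2 hcard).le (sq_nonneg _)
  have h0 := (Finset.sum_eq_zero_iff_of_nonneg hnn).1
    (le_antisymm (not_lt.1 hle) (Finset.sum_nonneg hnn))
  have hker : Submodule.span ℝ (S : Set (Fin p → ℝ)) ≤ (dotProductBilin ℝ ℝ c).ker := by
    rw [Submodule.span_le]
    intro s hs
    have := h0 ⟨s, hs⟩ (Finset.mem_univ _)
    rw [hg ⟨s, hs⟩] at this
    rcases mul_eq_zero.1 this with h | h
    · exact absurd h (inv_pos.2 hcard).ne'
    · exact pow_eq_zero_iff two_ne_zero |>.1 h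
  rw [← hSspan] at hker
  exact hc (dotProduct_self_eq_zero.1 (hker (Submodule.mem_top (x := c))))

/-- A vector orthogonal to F at every atom annihilates the quadratic form, so evaluation at the
atoms is injective on ℝ^p. -/
lemma le_card_of_infoMatrix_posDef {A : Matrix (Fin p) (MultiIdx n d) ℝ}
    {S : Finset (Fin n → ℝ)} {w : (Fin n → ℝ) → ℝ}
    (h : (infoMatrix A (atomicMoments (2 * d) S w)).PosDef) : p ≤ S.card := by
  have hle : Module.finrank ℝ (Fin p → ℝ) ≤ Module.finrank ℝ (S → ℝ) := by
    let B : Matrix S (Fin p) ℝ := Matrix.of fun x => regressor A x.1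
    refine LinearMap.finrank_le_finrank_of_injective (f := B.mulVecLin) ?_
    rw [← LinearMap.ker_eq_bot, LinearMap.ker_eq_bot']
    intro c hc
    by_contra hne
    have hpos := h.dotProduct_mulVec_pos hne
    rw [star_trivial, infoMatrix_atomicMoments, dotProduct_sum_vecMulVec] at hpos
    refine hpos.ne' (Finset.sum_eq_zero fun x hx => ?_)
    have : c ⬝ᵥ regressor A x = 0 := by
      rw [dotProduct_comm]
      exact congrFun hc ⟨x, hx⟩
    rw [this]
    ring
  simpa using hle

lemma productSpanDim_le_left (A : Matrix (Fin p) (MultiIdx n d) ℝ) :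
    productSpanDim A ≤ 1 + p * (p + 1) / 2 := by
  let b : Option (Sym2 (Fin p)) → (Fin n → ℝ) → ℝ := fun o => o.elim (fun _ => 1)
    (Sym2.lift ⟨fun i j x => regressor A x i * regressor A x j,
      fun i j => funext fun x => mul_comm _ _⟩)
  have h1 := finrank_range_le_card (R := ℝ) b
  have hfin : FiniteDimensional ℝ (Submodule.span ℝ (Set.range b)) :=
    FiniteDimensional.span_of_finite ℝ (Set.finite_range b)
  rw [Fintype.card_option, Sym2.card, Fintype.card_fin, Nat.choose_two_right,
    Nat.add_sub_cancel, add_comm, mul_comm] at h1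
  refine le_trans (Submodule.finrank_mono (Submodule.span_mono ?_)) h1
  rintro f (rfl | ⟨⟨i, j⟩, rfl⟩)
  · exact ⟨none, rfl⟩
  · exact ⟨some s(i, j), rfl⟩

lemma productSpanDim_le_right (A : Matrix (Fin p) (MultiIdx n d) ℝ) :
    productSpanDim A ≤ (n + 2 * d).choose n := by
  let b : MultiIdx n (2 * d) → (Fin n → ℝ) → ℝ := fun γ x => monomialVec (2 * d) x γ
  have h1 := finrank_range_le_card (R := ℝ) b
  have hfin : FiniteDimensional ℝ (Submodule.span ℝ (Set.range b)) :=
    FiniteDimensional.span_of_finite ℝ (Set.finite_range b)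
  rw [card_multiIdx] at h1
  refine le_trans (Submodule.finrank_mono (Submodule.span_le.2 ?_)) h1
  rintro f (rfl | ⟨⟨i, j⟩, rfl⟩)
  · exact Submodule.subset_span ⟨MultiIdx.zero n (2 * d), funext fun x => monomialVec_zero _ x⟩
  · have : (fun x => regressor A x i * regressor A x j) =
        ∑ α, ∑ β, (A i α * A j β) • b (α.add β) := by
      ext x
      simp only [Finset.sum_apply, Pi.smul_apply, smul_eq_mul, b, monomialVec_add, regressor,
        mulVec, dotProduct, Finset.sum_mul_sum]
      exact Finset.sum_congr rfl fun α _ => Finset.sum_congr rfl fun β _ => by ring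
    change (fun x => regressor A x i * regressor A x j) ∈ _
    rw [this]
    exact Submodule.sum_mem _ fun α _ => Submodule.sum_mem _ fun β _ =>
      Submodule.smul_mem _ _ (Submodule.subset_span ⟨_, rfl⟩)

/-! ### Optimal designs -/

/-- Makes the polynomial's value at x a linear functional of the moments of the point mass at x. -/
lemma christoffel_eq_trace (q : ℝ) (A : Matrix (Fin p) (MultiIdx n d) ℝ)
    (y : MultiIdx n (2 * d) → ℝ) (x : Fin n → ℝ) :
    christoffel q A y x =
      (matPow (infoMatrix A y) (q - 1) * infoMatrix A (monomialVec (2 * d) x)).trace := by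
  rw [infoMatrix_monomialVec, trace_mul_vecMulVec, christoffel]

lemma christoffel_eq_norm_sq {q : ℝ} {A : Matrix (Fin p) (MultiIdx n d) ℝ}
    {y : MultiIdx n (2 * d) → ℝ} (hy : (infoMatrix A y).PosDef) (x : Fin n → ℝ) :
    christoffel q A y x =
      ‖WithLp.toLp 2 ((matPow (infoMatrix A y) ((q - 1) / 2)).mulVec (regressor A x))‖ ^ 2 := by
  have h := matPow_mul_matPow hy ((q - 1) / 2) ((q - 1) / 2)
  rw [add_halves] at h
  have ht : (matPow (infoMatrix A y) ((q - 1) / 2))ᵀ = matPow (infoMatrix A y) ((q - 1) / 2) := by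
    rw [← conjTranspose_eq_transpose_of_trivial]
    exact matPow_isHermitian _
  rw [christoffel, ← h, ← mulVec_mulVec, dotProduct_mulVec, ← mulVec_transpose, ht,
    EuclideanSpace.norm_sq_eq, dotProduct]
  exact Finset.sum_congr rfl fun i _ => by simp [sq]

lemma isOptimalSolution_iff {q : ℝ} {A : Matrix (Fin p) (MultiIdx n d) ℝ}
    {X : Set (Fin n → ℝ)} {y : MultiIdx n (2 * d) → ℝ} :
    IsOptimalSolution q A X y ↔ y ∈ convexHull ℝ (monomialVec (2 * d) '' X) ∧
      ∀ z ∈ convexHull ℝ (monomialVec (2 * d) '' X),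
        kieferPhi q (infoMatrix A z) ≤ kieferPhi q (infoMatrix A y) := by
  rw [IsOptimalSolution, designFeasible_eq_convexHull]
  rfl

lemma exists_isOptimalSolution (hp : 1 ≤ p) {q : ℝ} (hq : q < 1)
    (A : Matrix (Fin p) (MultiIdx n d) ℝ) {X : Set (Fin n → ℝ)} (hX : IsCompact X)
    (hne : X.Nonempty) : ∃ y, IsOptimalSolution q A X y := by
  have hcpt := isCompact_convexHull (hX.image (continuous_monomialVec (n := n) (2 * d)))
  have husc : UpperSemicontinuousOn (fun z => kieferPhi q (infoMatrix A z))
      (convexHull ℝ (monomialVec (2 * d) '' X)) := by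
    intro z hz c hc
    obtain ⟨C, h1, h2⟩ := exists_linear_majorant hp hq (infoMatrix_posSemidef A hz) hc
    have hcont : Continuous fun z => (C * infoMatrixLin A z).trace :=
      Continuous.matrix_trace
        (continuous_const.mul (infoMatrixLin A).continuous_of_finiteDimensional)
    filter_upwards [(hcont.tendsto z).eventually_lt_const h1 |>.filter_mono nhdsWithin_le_nhds,
      self_mem_nhdsWithin] with z' h3 h4
    exact (h2 _ (infoMatrix_posSemidef A h4)).trans_lt h3
  obtain ⟨y, hy, hmax⟩ := husc.exists_isMaxOn (hne.image _).convexHull hcpt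
  exact ⟨y, isOptimalSolution_iff.2 ⟨hy, hmax⟩⟩

lemma IsOptimalSolution.kieferPhi_segment_le {q : ℝ} {A : Matrix (Fin p) (MultiIdx n d) ℝ}
    {X : Set (Fin n → ℝ)} {y : MultiIdx n (2 * d) → ℝ} (h : IsOptimalSolution q A X y)
    {z : MultiIdx n (2 * d) → ℝ} (hz : z ∈ convexHull ℝ (monomialVec (2 * d) '' X))
    (t : ℝ) (h0 : 0 < t) (h1 : t < 1) :
    kieferPhi q ((1 - t) • infoMatrix A y + t • infoMatrix A z) ≤
      kieferPhi q (infoMatrix A y) := by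
  rw [isOptimalSolution_iff] at h
  have e : (1 - t) • infoMatrix A y + t • infoMatrix A z =
      infoMatrix A ((1 - t) • y + t • z) := by
    change _ = infoMatrixLin A _
    rw [map_add, map_smul, map_smul]
    rfl
  rw [e]
  exact h.2 _ (convex_convexHull ℝ _ h.1 hz (by linarith) h0.le (by ring))

lemma IsOptimalSolution.posDef (hp : 1 ≤ p) {q : ℝ} (hq : q < 1)
    {A : Matrix (Fin p) (MultiIdx n d) ℝ} (hA : A.rank = p) {X : Set (Fin n → ℝ)}
    (hX : (interior X).Nonempty) {y : MultiIdx n (2 * d) → ℝ}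
    (h : IsOptimalSolution q A X y) : (infoMatrix A y).PosDef := by
  obtain ⟨z, hz, hzD⟩ := exists_posDef_infoMatrix hp hA hX
  exact posDef_of_kieferPhi_le hp hq
    (infoMatrix_posSemidef A (isOptimalSolution_iff.1 h).1) hzD (h.kieferPhi_segment_le hz)

lemma IsOptimalSolution.dualPoly_nonneg (hp : 1 ≤ p) {q : ℝ} (hq : q < 1)
    {A : Matrix (Fin p) (MultiIdx n d) ℝ} {X : Set (Fin n → ℝ)} {y : MultiIdx n (2 * d) → ℝ}
    (h : IsOptimalSolution q A X y) (hD : (infoMatrix A y).PosDef) :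
    ∀ x ∈ X, 0 ≤ dualPoly q A y x := by
  intro x hx
  have hz := subset_convexHull ℝ _ (Set.mem_image_of_mem (monomialVec (2 * d)) hx)
  rw [dualPoly, christoffel_eq_trace, sub_nonneg]
  exact trace_matPow_le_of_kieferPhi_le hp hq hD (infoMatrix_posSemidef A hz)
    (h.kieferPhi_segment_le hz)

lemma trace_mul_infoMatrix_le {q : ℝ} {A : Matrix (Fin p) (MultiIdx n d) ℝ}
    {X : Set (Fin n → ℝ)} {y : MultiIdx n (2 * d) → ℝ} (h : ∀ x ∈ X, 0 ≤ dualPoly q A y x)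
    {z : MultiIdx n (2 * d) → ℝ} (hz : z ∈ convexHull ℝ (monomialVec (2 * d) '' X)) :
    (matPow (infoMatrix A y) (q - 1) * infoMatrix A z).trace ≤
      (matPow (infoMatrix A y) q).trace := by
  have hconv : Convex ℝ {z | (matPow (infoMatrix A y) (q - 1) * infoMatrixLin A z).trace ≤
      (matPow (infoMatrix A y) q).trace} := by
    refine convex_halfSpace_le ⟨fun a b => ?_, fun c a => ?_⟩ _
    · rw [map_add, mul_add, trace_add]
    · rw [map_smul, mul_smul_comm, trace_smul]
  refine convexHull_min ?_ hconv hz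
  rintro _ ⟨x, hx, rfl⟩
  have := h x hx
  rw [dualPoly, christoffel_eq_trace, sub_nonneg] at this
  exact this

lemma isOptimalSolution_of_dualPoly_nonneg (hp : 1 ≤ p) {q : ℝ} (hq : q < 1)
    {A : Matrix (Fin p) (MultiIdx n d) ℝ} {X : Set (Fin n → ℝ)} {y : MultiIdx n (2 * d) → ℝ}
    (hy : y ∈ convexHull ℝ (monomialVec (2 * d) '' X)) (hD : (infoMatrix A y).PosDef)
    (h : ∀ x ∈ X, 0 ≤ dualPoly q A y x) : IsOptimalSolution q A X y := by
  refine isOptimalSolution_iff.2 ⟨hy, fun z hz => ?_⟩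
  have hp' : (0 : ℝ) < p := by exact_mod_cast hp
  have hpos := kieferPhi_pos (q := q) hp hD
  have h1 := (kieferPhi_mul_le hp hq hD (infoMatrix_posSemidef A hz)).trans
    (trace_mul_infoMatrix_le h hz)
  rw [← kieferPhi_rpow hp hD.posSemidef (Or.inl hD)] at h1
  have h2 : kieferPhi q (infoMatrix A y) ^ q =
      kieferPhi q (infoMatrix A y) ^ (q - 1) * kieferPhi q (infoMatrix A y) := by
    rw [← Real.rpow_add_one hpos.ne', sub_add_cancel]
  rw [h2, ← mul_assoc] at h1
  exact le_of_mul_le_mul_left h1 (mul_pos hp' (Real.rpow_pos_of_pos hpos _))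

lemma sum_eq_one_of_mem_convexHull {X : Set (Fin n → ℝ)} {k : ℕ}
    {S : Finset (Fin n → ℝ)} {w : (Fin n → ℝ) → ℝ}
    (h : ∑ x ∈ S, w x • monomialVec k x ∈ convexHull ℝ (monomialVec k '' X)) :
    ∑ x ∈ S, w x = 1 := by
  have hconv : Convex ℝ {z : MultiIdx n k → ℝ | z (MultiIdx.zero n k) = 1} := by
    intro a ha b hb s t _ _ hst
    simp only [Set.mem_ofPred_eq, Pi.add_apply, Pi.smul_apply, smul_eq_mul] at *
    rw [ha, hb, mul_one, mul_one, hst]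
  have := convexHull_min (by
    rintro _ ⟨x, -, rfl⟩
    exact monomialVec_zero k x) hconv h
  simpa [monomialVec_zero] using this

/-- Every optimal solution is carried by finitely many points of the contact set. -/
lemma exists_atomic_contactSet {q : ℝ} {A : Matrix (Fin p) (MultiIdx n d) ℝ}
    {X : Set (Fin n → ℝ)} {y : MultiIdx n (2 * d) → ℝ}
    (hy : y ∈ convexHull ℝ (monomialVec (2 * d) '' X)) (hD : (infoMatrix A y).PosDef)
    (h : ∀ x ∈ X, 0 ≤ dualPoly q A y x) :
    ∃ (S : Finset (Fin n → ℝ)) (w : (Fin n → ℝ) → ℝ),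
      (∀ x ∈ S, 0 < w x) ∧ (∀ x ∈ S, x ∈ contactSet q A X y) ∧
      y = atomicMoments (2 * d) S w ∧ S.card ≤ (n + 2 * d).choose n := by
  obtain ⟨S, w, hw, hS, hyS, hcard⟩ := exists_atomic_of_mem_convexHull
    (LinearMap.proj (MultiIdx.zero n (2 * d))) (fun x _ => monomialVec_zero (2 * d) x) hy
  rw [Module.finrank_fintype_fun_eq_card, card_multiIdx] at hcard
  refine ⟨S, w, hw, ?_, by rw [hyS, atomicMoments_eq_sum], hcard⟩
  have hw1 : ∑ x ∈ S, w x = 1 := sum_eq_one_of_mem_convexHull (hyS ▸ hy)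
  -- Complementary slackness: the christoffel values average to tr(M^(q-1) M) = tr(M^q). A sum of
  -- nonnegative terms then vanishes termwise.
  have hsum : ∑ x ∈ S, w x * dualPoly q A y x = 0 := by
    have e : (matPow (infoMatrix A y) q).trace = ∑ x ∈ S, w x * christoffel q A y x := by
      rw [← matPow_mul_self hD]
      simp only [christoffel_eq_trace]
      have e2 : infoMatrix A y = ∑ x ∈ S, w x • infoMatrix A (monomialVec (2 * d) x) := by
        conv_lhs => rw [hyS, ← atomicMoments_eq_sum, infoMatrix_atomicMoments]
        exact Finset.sum_congr rfl fun x _ => by rw [infoMatrix_monomialVec]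
      nth_rewrite 2 [e2]
      rw [Finset.mul_sum, trace_sum]
      exact Finset.sum_congr rfl fun x _ => by rw [mul_smul_comm, trace_smul, smul_eq_mul]
    simp only [dualPoly, mul_sub, Finset.sum_sub_distrib]
    rw [← Finset.sum_mul, hw1, one_mul, ← e, sub_self]
  intro x hx
  have := (Finset.sum_eq_zero_iff_of_nonneg
    fun x hx => mul_nonneg (hw x hx).le (h x (hS x hx))).1 hsum x hx
  exact ⟨hS x hx, (mul_eq_zero.1 this).resolve_left (hw x hx).ne'⟩

/-- The information matrix of an atomic measure is attained by few of its support points. -/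
lemma exists_atomic_card_le_productSpanDim (A : Matrix (Fin p) (MultiIdx n d) ℝ)
    {T : Set (Fin n → ℝ)} {S : Finset (Fin n → ℝ)} {w : (Fin n → ℝ) → ℝ}
    (hw : ∀ x ∈ S, 0 < w x) (hS : ∀ x ∈ S, x ∈ T) (hw1 : ∑ x ∈ S, w x = 1) :
    ∃ (S' : Finset (Fin n → ℝ)) (w' : (Fin n → ℝ) → ℝ),
      (∀ x ∈ S', 0 < w' x) ∧ (∀ x ∈ S', x ∈ T) ∧ ∑ x ∈ S', w' x = 1 ∧
      infoMatrix A (atomicMoments (2 * d) S' w') = infoMatrix A (atomicMoments (2 * d) S w) ∧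
      S'.card ≤ productSpanDim A := by
  set W := Submodule.span ℝ (insert (fun _ => (1 : ℝ))
      (Set.range fun ij : Fin p × Fin p =>
        fun x : Fin n → ℝ => regressor A x ij.1 * regressor A x ij.2)) with hW
  have hfin : FiniteDimensional ℝ W :=
    FiniteDimensional.span_of_finite ℝ ((Set.finite_range _).insert _)
  have h1 : (fun _ => (1 : ℝ)) ∈ W := Submodule.subset_span (Set.mem_insert _ _)
  have h2 : ∀ i j, (fun x => regressor A x i * regressor A x j) ∈ W := fun i j =>
    Submodule.subset_span (Set.mem_insert_of_mem _ ⟨(i, j), rfl⟩)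
  -- Carathéodory is applied to point evaluations on W, which determine mass and information matrix.
  -- Since 1 ∈ W, evaluations lie on a hyperplane, and the bound is dim W.
  let v : (Fin n → ℝ) → Module.Dual ℝ W := fun x => (LinearMap.proj x).comp W.subtype
  have hP : ∑ x ∈ S, w x • v x ∈ convexHull ℝ (v '' T) :=
    (convex_convexHull ℝ _).sum_mem (fun x hx => (hw x hx).le) hw1 fun x hx =>
      subset_convexHull ℝ _ ⟨x, hS x hx, rfl⟩
  obtain ⟨S', w', hw', hS', hPS, hcard⟩ := exists_atomic_of_mem_convexHull
    (Module.Dual.eval ℝ W ⟨_, h1⟩) (fun x _ => rfl) hP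
  rw [Subspace.dual_finrank_eq] at hcard
  have hval : ∀ f (hf : f ∈ W), ∑ x ∈ S', w' x * f x = ∑ x ∈ S, w x * f x := fun f hf => by
    have := congrArg (fun φ : Module.Dual ℝ W => φ ⟨f, hf⟩) hPS
    simpa [v, LinearMap.sum_apply] using this.symm
  refine ⟨S', w', hw', hS', ?_, ?_, hcard⟩
  · simpa [hw1] using hval _ h1
  · rw [infoMatrix_atomicMoments, infoMatrix_atomicMoments]
    ext i j
    simpa [Matrix.sum_apply, vecMulVec_apply] using hval _ (h2 i j)

lemma contactSet_congr {q : ℝ} {A : Matrix (Fin p) (MultiIdx n d) ℝ} {X : Set (Fin n → ℝ)}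
    {y z : MultiIdx n (2 * d) → ℝ} (h : infoMatrix A y = infoMatrix A z) :
    contactSet q A X y = contactSet q A X z := by
  simp only [contactSet, dualPoly, christoffel, h]

lemma IsOptimalSolution.exists_atomic (hp : 1 ≤ p) {q : ℝ} (hq : q < 1)
    {A : Matrix (Fin p) (MultiIdx n d) ℝ} {X : Set (Fin n → ℝ)} {y : MultiIdx n (2 * d) → ℝ}
    (h : IsOptimalSolution q A X y) (hD : (infoMatrix A y).PosDef) :
    (∃ (S : Finset (Fin n → ℝ)) (w : (Fin n → ℝ) → ℝ),
        (∀ x ∈ S, 0 < w x) ∧ (∀ x ∈ S, x ∈ contactSet q A X y) ∧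
        y = atomicMoments (2 * d) S w ∧ p ≤ S.card ∧ S.card ≤ (n + 2 * d).choose n) ∧
      (∃ (S : Finset (Fin n → ℝ)) (w : (Fin n → ℝ) → ℝ),
        (∀ x ∈ S, 0 < w x) ∧ (∀ x ∈ S, x ∈ contactSet q A X y) ∧
        IsOptimalSolution q A X (atomicMoments (2 * d) S w) ∧
        infoMatrix A (atomicMoments (2 * d) S w) = infoMatrix A y ∧
        p ≤ S.card ∧ S.card ≤ productSpanDim A) := by
  have hy := isOptimalSolution_iff.1 h
  obtain ⟨S, w, hw, hS, hyS, hcard⟩ :=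
    exists_atomic_contactSet hy.1 hD (h.dualPoly_nonneg hp hq hD)
  refine ⟨⟨S, w, hw, hS, hyS, le_card_of_infoMatrix_posDef (hyS ▸ hD), hcard⟩, ?_⟩
  have hw1 : ∑ x ∈ S, w x = 1 :=
    sum_eq_one_of_mem_convexHull (by rw [← atomicMoments_eq_sum, ← hyS]; exact hy.1)
  obtain ⟨S', w', hw', hS', hw1', hinfo, hcard'⟩ :=
    exists_atomic_card_le_productSpanDim A hw hS hw1
  rw [← hyS] at hinfo
  refine ⟨S', w', hw', hS', isOptimalSolution_iff.2 ⟨?_, ?_⟩, hinfo,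
    le_card_of_infoMatrix_posDef (hinfo ▸ hD), hcard'⟩
  · rw [atomicMoments_eq_sum]
    exact (convex_convexHull ℝ _).sum_mem (fun x hx => (hw' x hx).le) hw1' fun x hx =>
      subset_convexHull ℝ _ ⟨x, (hS' x hx).1, rfl⟩
  · rw [hinfo]
    exact hy.2

lemma momentMatrix_injective :
    Function.Injective (momentMatrix : (MultiIdx n (2 * d) → ℝ) → _) := by
  intro y z h
  ext γ
  -- If |γ| exceeds d, split off a part of order exactly d; at most d remains.
  obtain ⟨α, β, rfl⟩ : ∃ α β : MultiIdx n d, γ = α.add β := by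
    rcases le_total γ.1.degree d with hd | hd
    · exact ⟨⟨γ.1, hd⟩, MultiIdx.zero n d, Subtype.ext (add_zero _).symm⟩
    · obtain ⟨α, hα, hαd⟩ := Finsupp.exists_le_degree_eq γ.1 d hd
      have hadd : α + (γ.1 - α) = γ.1 := add_tsub_cancel_of_le hα
      have hdeg := congrArg Finsupp.degree hadd
      rw [map_add] at hdeg
      have := γ.2
      exact ⟨⟨α, hαd.le⟩, ⟨γ.1 - α, by omega⟩, Subtype.ext hadd.symm⟩
  exact congrFun (congrFun h α) β

lemma infoMatrix_injective {A : Matrix (Fin p) (MultiIdx n d) ℝ}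
    (hA : A.rank = (n + d).choose n) : Function.Injective (infoMatrix A) := by
  classical
  intro y z h
  have hinj : Function.Injective A.mulVec :=
    mulVec_injective_of_rank_eq (by rw [hA, card_multiIdx])
  apply momentMatrix_injective
  have h1 : A * ((momentMatrix y - momentMatrix z) * Aᵀ) = 0 := by
    rw [← Matrix.mul_assoc, Matrix.mul_sub, Matrix.sub_mul, sub_eq_zero]
    exact h
  have h2 := congrArg transpose (eq_zero_of_mul_eq_zero hinj h1)
  rw [transpose_mul, transpose_transpose, transpose_zero] at h2
  have h3 := congrArg transpose (eq_zero_of_mul_eq_zero hinj h2)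
  rw [transpose_transpose, transpose_zero, sub_eq_zero] at h3
  exact h3

/-- The first-order condition at y, tested on z, is the hypothesis of Hölder's equality case. -/
lemma IsOptimalSolution.infoMatrix_eq (hp : 1 ≤ p) {q : ℝ} (hq : q < 1)
    {A : Matrix (Fin p) (MultiIdx n d) ℝ} {X : Set (Fin n → ℝ)}
    {y z : MultiIdx n (2 * d) → ℝ} (hy : IsOptimalSolution q A X y)
    (hz : IsOptimalSolution q A X z) (hyD : (infoMatrix A y).PosDef)
    (hzD : (infoMatrix A z).PosDef) : infoMatrix A y = infoMatrix A z := by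
  have hy' := isOptimalSolution_iff.1 hy
  have hz' := isOptimalSolution_iff.1 hz
  exact eq_of_trace_le hp hq hyD hzD (le_antisymm (hz'.2 y hy'.1) (hy'.2 z hz'.1))
    (trace_mul_infoMatrix_le (hy.dualPoly_nonneg hp hq hyD) hz'.1)

end

end OptDesign

end

/-! ### Optimal designs and their equivalence theorem -/

theorem mainTheorem4 (n d p m : ℕ) (hp : 1 ≤ p) (q : ℝ) (hq : q < 1)
    (g : Fin m → MvPolynomial (Fin n) ℝ) (X : Set (Fin n → ℝ))
    (hX : X = OptDesign.designSpace g) (hcomp : IsCompact X) (hint : (interior X).Nonempty)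
    (A : Matrix (Fin p) (OptDesign.MultiIdx n d) ℝ) (hA : A.rank = p) :
    -- the design problem and the moment problem have the same feasible moment vectors
    OptDesign.designFeasible A X = OptDesign.normalizedMoments (2 * d) X ∧
    -- convex optimization problem: concave objective on a convex feasible set
    ConcaveOn ℝ (OptDesign.designFeasible A X)
      (fun y => OptDesign.kieferPhi q (OptDesign.infoMatrix A y)) ∧
    -- there is an optimal solution which comes from an atomic measure with few atoms
    (∃ y, OptDesign.IsOptimalSolution q A X y ∧
      ∃ (S : Finset (Fin n → ℝ)) (w : (Fin n → ℝ) → ℝ),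
        (∀ x ∈ S, 0 < w x) ∧ (∀ x ∈ S, x ∈ OptDesign.contactSet q A X y) ∧
        y = OptDesign.atomicMoments (2 * d) S w ∧
        p ≤ S.card ∧ S.card ≤ OptDesign.productSpanDim A) ∧
    OptDesign.productSpanDim A ≤ min (1 + p * (p + 1) / 2) ((n + 2 * d).choose n) ∧
    -- every optimal solution
    (∀ y, OptDesign.IsOptimalSolution q A X y →
      (OptDesign.infoMatrix A y).PosDef ∧
      (∀ x, OptDesign.christoffel q A y x =
        ‖WithLp.toLp 2 ((OptDesign.matPow (OptDesign.infoMatrix A y) ((q - 1) / 2)).mulVec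
          (OptDesign.regressor A x))‖ ^ 2) ∧
      -- `y` itself comes from an atomic measure on the contact set
      (∃ (S : Finset (Fin n → ℝ)) (w : (Fin n → ℝ) → ℝ),
        (∀ x ∈ S, 0 < w x) ∧ (∀ x ∈ S, x ∈ OptDesign.contactSet q A X y) ∧
        y = OptDesign.atomicMoments (2 * d) S w ∧
        p ≤ S.card ∧ S.card ≤ (n + 2 * d).choose n) ∧
      -- its information matrix comes from an optimal atomic measure with few atoms
      (∃ (S : Finset (Fin n → ℝ)) (w : (Fin n → ℝ) → ℝ),
        (∀ x ∈ S, 0 < w x) ∧ (∀ x ∈ S, x ∈ OptDesign.contactSet q A X y) ∧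
        OptDesign.IsOptimalSolution q A X (OptDesign.atomicMoments (2 * d) S w) ∧
        OptDesign.infoMatrix A (OptDesign.atomicMoments (2 * d) S w) =
          OptDesign.infoMatrix A y ∧
        p ≤ S.card ∧ S.card ≤ OptDesign.productSpanDim A)) ∧
    -- the equivalence theorem
    (∀ y, OptDesign.IsOptimalSolution q A X y ↔
      y ∈ OptDesign.normalizedMoments (2 * d) X ∧ (OptDesign.infoMatrix A y).PosDef ∧
        ∀ x ∈ X, 0 ≤ OptDesign.dualPoly q A y x) ∧
    -- uniqueness when `A` has full column rank
    (A.rank = (n + d).choose n → ∃! y, OptDesign.IsOptimalSolution q A X y) := by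
  have hpos : ∀ y, OptDesign.IsOptimalSolution q A X y → (OptDesign.infoMatrix A y).PosDef :=
    fun y hy => hy.posDef hp hq hA hint
  have hfeas := OptDesign.designFeasible_eq_convexHull A X
  have hnorm : OptDesign.normalizedMoments (2 * d) X =
      convexHull ℝ (OptDesign.monomialVec (2 * d) '' X) :=
    (OptDesign.normalizedMoments_subset_convexHull (2 * d) hcomp).antisymm
      (OptDesign.convexHull_subset_normalizedMoments (2 * d) hcomp.measurableSet)
  obtain ⟨y₀, hy₀⟩ := OptDesign.exists_isOptimalSolution hp hq A hcomp
    (hint.mono interior_subset)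
  refine ⟨by rw [hfeas, hnorm], ?_, ?_, le_min (OptDesign.productSpanDim_le_left A)
    (OptDesign.productSpanDim_le_right A), ?_, ?_, ?_⟩
  · rw [hfeas]
    refine ⟨convex_convexHull ℝ _, fun y hy z hz a b ha hb _ => ?_⟩
    refine (OptDesign.kieferPhi_concave hp hq (OptDesign.infoMatrix_posSemidef A hy)
      (OptDesign.infoMatrix_posSemidef A hz) ha hb).trans_eq ?_
    congr 1
    change _ = OptDesign.infoMatrixLin A _
    rw [map_add, map_smul, map_smul]
    rfl
  · obtain ⟨S, w, hw, hS, hopt, hinfo, hcard⟩ := (hy₀.exists_atomic hp hq (hpos _ hy₀)).2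
    refine ⟨_, hopt, S, w, hw, ?_, rfl, hcard⟩
    -- The reduced design may have other moments than y₀, but the contact set depends only on the
    -- information matrix.
    rwa [OptDesign.contactSet_congr hinfo]
  · intro y hy
    have hex := hy.exists_atomic hp hq (hpos _ hy)
    exact ⟨hpos _ hy, OptDesign.christoffel_eq_norm_sq (hpos _ hy), hex.1, hex.2⟩
  · intro y
    rw [hnorm]
    exact ⟨fun hy => ⟨(OptDesign.isOptimalSolution_iff.1 hy).1, hpos _ hy,
      hy.dualPoly_nonneg hp hq (hpos _ hy)⟩,
      fun h => OptDesign.isOptimalSolution_of_dualPoly_nonneg hp hq h.1 h.2.1 h.2.2⟩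
  · intro hrank
    exact ⟨y₀, hy₀, fun y hy => OptDesign.infoMatrix_injective hrank
      (hy.infoMatrix_eq hp hq hy₀ (hpos _ hy) (hpos _ hy₀))⟩
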